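/- Let $\ell,R>0$ and $\Lambda=-2/\ell^2$. Consider three-dimensional Einstein--Maxwell theory $$R_{\mu\nu}=2\mathcal F_{\mu\sigma}\mathcal F_\nu{}^{\sigma}-g_{\mu\nu}\mathcal F_{\rho\sigma}\mathcal F^{\rho\sigma}+\Lambda g_{\mu\nu},\qquad \mathrm d\ast\mathcal F=0,\qquad \mathrm d\mathcal F=0,$$ and extreme horizons with cross-section the circle $S^1$ with coordinate $x\sim x+2\pi R$ and induced metric $\mathrm dx^2$. Below all functions of $x$ are smooth and $2\pi R$-periodic, and $\overline{u}=\frac1{2\pi R}\int_0^{2\pi R}u$. A near-horizon geometry is a solution of the form $$g^{(0)}=2\,\mathrm dv\left(\mathrm dr+r h^{(0)}\mathrm dx+\tfrac12 r^2F^{(0)}\mathrm dv\right)+\mathrm dx^2,\qquad \mathcal F^{(0)}=\Psi^{(0)}\mathrm dv\wedge \mathrm dr+rW^{(0)}\mathrm dv\wedge \mathrm dx .$$ A transverse deformation of it is a solution $(g^{(1)},\mathcal F^{(1)})$ of the Einstein--Maxwell equations linearised at $(g^{(0)},\mathcal F^{(0)})$ of the form $$g^{(1)}=r^3F^{(1)}\mathrm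 dv^2+2r^2h^{(1)}\mathrm dv\,\mathrm dx+r\gamma^{(1)}\mathrm dx^2,\qquad \mathcal F^{(1)}=r\Psi^{(1)}\mathrm dv\wedge \mathrm dr+r^2W^{(1)}\mathrm dv\wedge \mathrm dx+Z^{(1)}\mathrm dr\wedge \mathrm dx .$$ A gauge transformation is $(g^{(1)},\mathcal F^{(1)})\mapsto(g^{(1)}-\mathcal L_\xi g^{(0)},\ \mathcal F^{(1)}-\mathcal L_\xi\mathcal F^{(0)})$ with $\xi=\tfrac12 f\partial_v+\tfrac14r^2h^{(0)}f'\partial_r-\tfrac12 rf'\partial_x$ for a function $f$ of $x$. (0) The near-horizon geometries are exactly: (i) $AdS_2\times S^1$, with $F^{(0)}=-2\ell^{-2}$, $h^{(0)}=0$, $\Psi^{(0)}=\pm\ell^{-1}$, $W^{(0)}=0$; (ii) locally $AdS_3$, with $F^{(0)}=0$, $h^{(0)}=\pm2\ell^{-1}$, $\Psi^{(0)}=0$, $W^{(0)}=0$. (i) In case (i), the transverse deformations are exactly the data given by an arbitrary function $\gamma^{(1)}$ and an arbitrary constant $a$ through $$Z^{(1)}(x)=a+\tfrac12\Psi^{(0)}\int_0^x(\gamma^{(1)}-b),\quad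 b=\overline{\gamma^{(1)}},\qquad h^{(1)}=2\Psi^{(0)}Z^{(1)},\quad F^{(1)}=\tfrac13(\Psi^{(0)})^2b,\quad \Psi^{(1)}=-\tfrac12\Psi^{(0)}b,\quad W^{(1)}=0 .$$ Gauge transformations map deformations to deformations and act by $\gamma^{(1)}\mapsto\gamma^{(1)}+f''$. Up to its mean, $\gamma^{(1)}$ is pure gauge: a given function $u$ occurs as the $\gamma^{(1)}$ of a deformation gauge equivalent to a given one if and only if $\overline u=\overline{\gamma^{(1)}}$. Every deformation is gauge equivalent to one with constant $Z^{(1)}=a$ and constant $\gamma^{(1)}=b$ (the other data being given by the formulas above), for a unique pair $(a,b)\in\mathbb R^2$. (ii) In case (ii), the transverse deformations are exactly the data given by an arbitrary function $\gamma^{(1)}$ through $Z^{(1)}=0$, $h^{(1)}=\tfrac14h^{(0)}\gamma^{(1)}$, $F^{(1)}=0$, $\Psi^{(1)}=0$, $W^{(1)}=0$. Equivalently, they are exactly the data with $Z^{(1)}=\Psi^{(1)}=W^{(1)}=0$ whose $g^{(1)}$ solves the linearised vacuum Einstein equation $R_{\mu\nu}=\Lambda g_{\mu\nu}$ at $g^{(0)}$.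 -/

import Mathlib

open scoped ContDiff

noncomputable section

namespace ExtremeHorizon

/-! Three-dimensional tensor calculus in the coordinates `(v, r, x)`, numbered `0, 1, 2`. -/

/-- Points of the coordinate space. -/
abbrev Pt : Type := Fin 3 → ℝ

/-- Fields of covariant 2-tensors, by components. -/
abbrev Tensor2 : Type := Pt → Matrix (Fin 3) (Fin 3) ℝ

/-- The partial derivative of `f` with respect to the `i`-th coordinate at `p`. -/
def pd (i : Fin 3) (f : Pt → ℝ) (p : Pt) : ℝ :=
  deriv (fun t : ℝ => f (Function.update p i t)) (p i)

/-- Christoffel symbols `Γ^a_{bc}` of the metric `g`. -/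
def christoffel (g : Tensor2) (a b c : Fin 3) (p : Pt) : ℝ :=
  (1 / 2) * ∑ d, (g p)⁻¹ a d *
    (pd b (fun q => g q d c) p + pd c (fun q => g q d b) p - pd d (fun q => g q b c) p)

/-- Ricci tensor `R_{bc}` of the metric `g`. -/
def ricci (g : Tensor2) (b c : Fin 3) (p : Pt) : ℝ :=
  ∑ a, (pd a (christoffel g a b c) p - pd c (christoffel g a b a) p)
    + ∑ a, ∑ d, (christoffel g a a d p * christoffel g d b c p
        - christoffel g a c d p * christoffel g d b a p)

/-- The contraction `M_{bs} M_c^s`. -/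
def maxwellSq (g M : Tensor2) (b c : Fin 3) (p : Pt) : ℝ :=
  ∑ s, ∑ t, (g p)⁻¹ s t * M p b s * M p c t

/-- The scalar `M_{rs} M^{rs}`. -/
def maxwellNormSq (g M : Tensor2) (p : Pt) : ℝ :=
  ∑ b, ∑ c, (g p)⁻¹ b c * maxwellSq g M b c p

/-- Left side minus right side of the Einstein equation in dimension `D = 3`,
`R_{bc} = 2 M_{bs} M_c^s - (1 / (D - 2)) g_{bc} M_{rs} M^{rs} + Λ g_{bc}`. -/
def einsteinEq (Λ : ℝ) (g M : Tensor2) (b c : Fin 3) (p : Pt) : ℝ :=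
  ricci g b c p
    - (2 * maxwellSq g M b c p - g p b c * maxwellNormSq g M p + Λ * g p b c)

/-- The covariant derivative `∇_a M_{bc}`. -/
def covDeriv (g M : Tensor2) (a b c : Fin 3) (p : Pt) : ℝ :=
  pd a (fun q => M q b c) p
    - ∑ s, (christoffel g s a b p * M p s c + christoffel g s a c p * M p b s)

/-- The divergence `g^{ab} ∇_a M_{bc}`, whose vanishing is the Maxwell equation `d ∗ M = 0`. -/
def maxwellEq (g M : Tensor2) (c : Fin 3) (p : Pt) : ℝ :=
  ∑ a, ∑ b, (g p)⁻¹ a b * covDeriv g M a b c p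

/-- Components of the exterior derivative of the 2-form `M`. -/
def extDeriv2 (M : Tensor2) (a b c : Fin 3) (p : Pt) : ℝ :=
  pd a (fun q => M q b c) p + pd b (fun q => M q c a) p + pd c (fun q => M q a b) p

/-- Lie derivative of the covariant 2-tensor `T` along the vector field `ξ`. -/
def lieDeriv (ξ : Pt → Fin 3 → ℝ) (T : Tensor2) : Tensor2 := fun p =>
  Matrix.of fun b c => ∑ s, (ξ p s * pd s (fun q => T q b c) p
    + T p s c * pd b (fun q => ξ q s) p + T p b s * pd c (fun q => ξ q s) p)

/-- The Einstein–Maxwell equations with cosmological constant `Λ`. -/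
def EinsteinMaxwell (Λ : ℝ) (g M : Tensor2) : Prop :=
  (∀ b c p, einsteinEq Λ g M b c p = 0) ∧ (∀ c p, maxwellEq g M c p = 0) ∧
    ∀ a b c p, extDeriv2 M a b c p = 0

/-- The Einstein–Maxwell equations linearised at `(g₀, M₀)`, for the perturbation `(g₁, M₁)`. -/
def LinEinsteinMaxwell (Λ : ℝ) (g₀ M₀ g₁ M₁ : Tensor2) : Prop :=
  (∀ b c p, HasDerivAt
    (fun ε : ℝ => einsteinEq Λ (fun q => g₀ q + ε • g₁ q) (fun q => M₀ q + ε • M₁ q) b c p) 0 0) ∧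
  (∀ c p, HasDerivAt
    (fun ε : ℝ => maxwellEq (fun q => g₀ q + ε • g₁ q) (fun q => M₀ q + ε • M₁ q) c p) 0 0) ∧
  ∀ a b c p, extDeriv2 M₁ a b c p = 0

/-- The vacuum Einstein equation `R_{bc} = Λ g_{bc}` linearised at `g₀`. -/
def LinVacuumEinstein (Λ : ℝ) (g₀ g₁ : Tensor2) : Prop :=
  ∀ b c p, HasDerivAt
    (fun ε : ℝ => ricci (fun q => g₀ q + ε • g₁ q) b c p - Λ * (g₀ p + ε • g₁ p) b c) 0 0

/-! Extreme horizons with cross-section a circle of length `2πR`. Functions on the circle are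
smooth `2πR`-periodic functions of the arc-length coordinate `x`, in which the induced metric
is `dx²`. -/

/-- Smooth functions on the circle of length `2πR`. -/
def SmoothPeriodic (R : ℝ) (u : ℝ → ℝ) : Prop :=
  ContDiff ℝ ∞ u ∧ Function.Periodic u (2 * Real.pi * R)

/-- The mean value of a function on the circle of length `2πR`. -/
def mean (R : ℝ) (u : ℝ → ℝ) : ℝ :=
  (1 / (2 * Real.pi * R)) * ∫ x in (0 : ℝ)..(2 * Real.pi * R), u x

/-- Horizon data `F⁽⁰⁾, h⁽⁰⁾, Ψ⁽⁰⁾, W⁽⁰⁾` (with `γ⁽⁰⁾ = 1`). -/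
@[ext] structure HorizonData where
  F : ℝ → ℝ
  h : ℝ → ℝ
  Ψ : ℝ → ℝ
  W : ℝ → ℝ

/-- First order data `F⁽¹⁾, h⁽¹⁾, γ⁽¹⁾, Ψ⁽¹⁾, W⁽¹⁾, Z⁽¹⁾`. -/
@[ext] structure FirstOrderData where
  F : ℝ → ℝ
  h : ℝ → ℝ
  γ : ℝ → ℝ
  Ψ : ℝ → ℝ
  W : ℝ → ℝ
  Z : ℝ → ℝ

/-- `g⁽⁰⁾ = 2 dv (dr + r h⁽⁰⁾ dx + ½ r² F⁽⁰⁾ dv) + dx²`. -/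
def HorizonData.metric (H : HorizonData) : Tensor2 := fun p =>
  !![p 1 ^ 2 * H.F (p 2), 1, p 1 * H.h (p 2);
     1, 0, 0;
     p 1 * H.h (p 2), 0, 1]

/-- `Ψ⁽⁰⁾ dv ∧ dr + r W⁽⁰⁾ dv ∧ dx`. -/
def HorizonData.maxwell (H : HorizonData) : Tensor2 := fun p =>
  !![0, H.Ψ (p 2), p 1 * H.W (p 2);
     -H.Ψ (p 2), 0, 0;
     -(p 1 * H.W (p 2)), 0, 0]

/-- `g⁽¹⁾ = r³ F⁽¹⁾ dv² + 2 r² h⁽¹⁾ dv dx + r γ⁽¹⁾ dx²`. -/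
def FirstOrderData.metric (d : FirstOrderData) : Tensor2 := fun p =>
  !![p 1 ^ 3 * d.F (p 2), 0, p 1 ^ 2 * d.h (p 2);
     0, 0, 0;
     p 1 ^ 2 * d.h (p 2), 0, p 1 * d.γ (p 2)]

/-- `r Ψ⁽¹⁾ dv ∧ dr + r² W⁽¹⁾ dv ∧ dx + Z⁽¹⁾ dr ∧ dx`. -/
def FirstOrderData.maxwell (d : FirstOrderData) : Tensor2 := fun p =>
  !![0, p 1 * d.Ψ (p 2), p 1 ^ 2 * d.W (p 2);
     -(p 1 * d.Ψ (p 2)), 0, d.Z (p 2);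
     -(p 1 ^ 2 * d.W (p 2)), -d.Z (p 2), 0]

/-- `H` is the data of a near-horizon geometry solving the Einstein–Maxwell equations. -/
def IsNearHorizonGeometry (Λ R : ℝ) (H : HorizonData) : Prop :=
  SmoothPeriodic R H.F ∧ SmoothPeriodic R H.h ∧ SmoothPeriodic R H.Ψ ∧ SmoothPeriodic R H.W ∧
    EinsteinMaxwell Λ H.metric H.maxwell

/-- `d` is an (electrovacuum) transverse deformation of the horizon `H`. -/
def IsTransverseDeformation (Λ R : ℝ) (H : HorizonData) (d : FirstOrderData) : Prop :=
  SmoothPeriodic R d.F ∧ SmoothPeriodic R d.h ∧ SmoothPeriodic R d.γ ∧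
    SmoothPeriodic R d.Ψ ∧ SmoothPeriodic R d.W ∧ SmoothPeriodic R d.Z ∧
    LinEinsteinMaxwell Λ H.metric H.maxwell d.metric d.maxwell

/-- The metric part of `d` is a vacuum transverse deformation of the metric of `H`. -/
def IsVacuumDeformation (Λ R : ℝ) (H : HorizonData) (d : FirstOrderData) : Prop :=
  SmoothPeriodic R d.F ∧ SmoothPeriodic R d.h ∧ SmoothPeriodic R d.γ ∧
    LinVacuumEinstein Λ H.metric d.metric

/-- The vector field `ξ = ½ f ∂_v + ¼ r² h⁽⁰⁾ f' ∂_r - ½ r f' ∂_x` of a supertranslation. -/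
def gaugeVector (H : HorizonData) (f : ℝ → ℝ) : Pt → Fin 3 → ℝ := fun p =>
  ![(1 / 2) * f (p 2), (1 / 4) * p 1 ^ 2 * H.h (p 2) * deriv f (p 2),
    -((1 / 2) * p 1 * deriv f (p 2))]

/-- `d'` arises from `d` by the gauge transformation `g⁽¹⁾ - L_ξ g⁽⁰⁾`, `M⁽¹⁾ - L_ξ M⁽⁰⁾`
generated by `f`. -/
def IsGaugeTransform (H : HorizonData) (f : ℝ → ℝ) (d d' : FirstOrderData) : Prop :=
  (∀ p, d'.metric p = d.metric p - lieDeriv (gaugeVector H f) H.metric p) ∧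
    ∀ p, d'.maxwell p = d.maxwell p - lieDeriv (gaugeVector H f) H.maxwell p

/-- Gauge equivalence of first order data, by a smooth function `f` on the circle. -/
def GaugeEquivalent (R : ℝ) (H : HorizonData) (d d' : FirstOrderData) : Prop :=
  ∃ f : ℝ → ℝ, SmoothPeriodic R f ∧ IsGaugeTransform H f d d'

/-- AdS₂ × S¹ horizon data, `Ψ⁽⁰⁾ = σ / ℓ` with `σ = ±1`. -/
def adS2S1 (ℓ σ : ℝ) : HorizonData where
  F := fun _ => -2 / ℓ ^ 2
  h := fun _ => 0
  Ψ := fun _ => σ / ℓ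
  W := fun _ => 0

/-- Locally AdS₃ horizon data, `h⁽⁰⁾ = 2 σ / ℓ` with `σ = ±1`. -/
def localAdS3 (ℓ σ : ℝ) : HorizonData where
  F := fun _ => 0
  h := fun _ => 2 * σ / ℓ
  Ψ := fun _ => 0
  W := fun _ => 0

/-- The first order data with constant `Z⁽¹⁾ = a` and constant `γ⁽¹⁾ = b`, for `Ψ⁽⁰⁾ = ψ`. -/
def constData (ψ a b : ℝ) : FirstOrderData where
  F := fun _ => (1 / 3) * ψ ^ 2 * b
  h := fun _ => 2 * ψ * a
  γ := fun _ => b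
  Ψ := fun _ => -((1 / 2) * ψ * b)
  W := fun _ => 0
  Z := fun _ => a

end ExtremeHorizon

end

noncomputable section

namespace ExtremeHorizon

/-! Background and perturbed metrics all have the form `A dv² + 2 dv dr + 2 B dv dx + C dx²` with
coefficients depending on `(r, x)` only. Its determinant is `-C`, so the Ricci tensor, the Maxwell
source and the Maxwell divergence are polynomials in `1 / C` and the 2-jets of the coefficients.
They are tabulated once; evaluating them at `ε = 0` gives the horizon equations and differentiating
them there gives the linearised equations (`linEinsteinMaxwell_iff`).

Horizons (`periodic_horizon_solutions`): the equations reduce to `h' = h²/2 + 2Ψ² + Λ`, `Ψ' = hΨ`,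
with `F` and `W` determined. A periodic function with derivative of one sign is constant. This is
applied to `h` if `Ψ` vanishes, and otherwise to `h (2Ψ² + Λ) exp(-½∫h)`, whose derivative is a
positive multiple of `(2Ψ² + Λ)² + 4(hΨ)²`.

AdS₂ × S¹: with `ψ` the background field, the linearised system is equivalent to `h = 2ψZ`, `Z' = Ψ
+ ½ψγ`, `F = -⅔ψΨ`, `W = 0`, `Ψ' = 0`. Periodicity of `Z` fixes the constant `Ψ` through the mean of
`γ`. Gauge transformations add `f''` to `γ` and `½ψf'` to `Z`. Every function of mean zero is some
`f''`, so `γ` can be made constant, and the means of `Z` and `γ` are the complete invariants.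

Locally AdS₃: the background Maxwell field vanishes and the source is quadratic in it, so the
linearised Einstein and Maxwell equations decouple. The Maxwell part becomes `Ψ' = 2hΨ`, then `Z' =
hZ` with `h ≠ 0` constant, which has no nonzero periodic solution. The Einstein part determines
everything from `γ`. -/

/-- A function of `(r, x)` together with candidates for its partial derivatives up to second
order. -/
structure Jet where
  val : ℝ → ℝ → ℝ
  dr : ℝ → ℝ → ℝ
  dx : ℝ → ℝ → ℝ
  drr : ℝ → ℝ → ℝ
  drx : ℝ → ℝ → ℝ
  dxx : ℝ → ℝ → ℝ

/-- The components of the jet are the partial derivatives of its value. -/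
structure Jet.Holonomic (A : Jet) : Prop where
  val_r : ∀ r x, HasDerivAt (fun s => A.val s x) (A.dr r x) r
  val_x : ∀ r x, HasDerivAt (fun s => A.val r s) (A.dx r x) x
  dr_r : ∀ r x, HasDerivAt (fun s => A.dr s x) (A.drr r x) r
  dr_x : ∀ r x, HasDerivAt (fun s => A.dr r s) (A.drx r x) x
  dx_r : ∀ r x, HasDerivAt (fun s => A.dx s x) (A.drx r x) r
  dx_x : ∀ r x, HasDerivAt (fun s => A.dx r s) (A.dxx r x) x

/-! ### Component tables for the metric ansatz, its inverse and their derivatives. -/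

/-- The vector with components `a`, `b`, `c`. -/
def vec3 (a b c : ℝ) (i : Fin 3) : ℝ := ![a, b, c] i

/-- These rules let `simp only` select an entry at a literal index, so the tables below reduce to
explicit expressions for `ring`. -/
theorem vec3_zero (a b c : ℝ) : vec3 a b c 0 = a := rfl

theorem vec3_one (a b c : ℝ) : vec3 a b c 1 = b := rfl

theorem vec3_two (a b c : ℝ) : vec3 a b c 2 = c := rfl

/-- The metric `A dv² + 2 dv dr + 2 B dv dx + C dx²`. -/
def jetMetric (A B C : Jet) : Tensor2 := fun p =>
  !![A.val (p 1) (p 2), 1, B.val (p 1) (p 2);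
     1, 0, 0;
     B.val (p 1) (p 2), 0, C.val (p 1) (p 2)]

/-- The inverse of `jetMetric A B C`. -/
def jetInv (A B C : Jet) (p : Pt) (i : Fin 3) : Fin 3 → ℝ :=
  vec3 (vec3 0 1 0 i)
    (vec3 1 (B.val (p 1) (p 2) * B.val (p 1) (p 2) * (C.val (p 1) (p 2))⁻¹ - A.val (p 1) (p 2))
      (-(B.val (p 1) (p 2) * (C.val (p 1) (p 2))⁻¹)) i)
    (vec3 0 (-(B.val (p 1) (p 2) * (C.val (p 1) (p 2))⁻¹)) (C.val (p 1) (p 2))⁻¹ i)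

/-- The components of the symmetric tensor `a dv² + 2 b dv dx + c dx²`. -/
def symEntry (a b c : ℝ) (i j : Fin 3) : ℝ :=
  vec3 (vec3 a 0 b j) 0 (vec3 b 0 c j) i

/-- The gradient of a jet. -/
def Jet.grad (A : Jet) (p : Pt) (i : Fin 3) : ℝ := vec3 0 (A.dr (p 1) (p 2)) (A.dx (p 1) (p 2)) i

/-- The Hessian of a jet. -/
def Jet.hess (A : Jet) (p : Pt) (i j : Fin 3) : ℝ :=
  vec3 0 (vec3 0 (A.drr (p 1) (p 2)) (A.drx (p 1) (p 2)) i)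
    (vec3 0 (A.drx (p 1) (p 2)) (A.dxx (p 1) (p 2)) i) j

/-- The first derivatives of `jetMetric A B C`. -/
def jetMetricDeriv (A B C : Jet) (i : Fin 3) (p : Pt) (b c : Fin 3) : ℝ :=
  symEntry (A.grad p i) (B.grad p i) (C.grad p i) b c

/-- The second derivatives of `jetMetric A B C`. -/
def jetMetricDeriv2 (A B C : Jet) (i j : Fin 3) (p : Pt) (b c : Fin 3) : ℝ :=
  symEntry (A.hess p i j) (B.hess p i j) (C.hess p i j) b c

/-- The first derivatives of `jetInv A B C`. -/
def jetInvDeriv (A B C : Jet) (i : Fin 3) (p : Pt) (b : Fin 3) : Fin 3 → ℝ :=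
  vec3 0
    (vec3 0 ((B.grad p i * B.val (p 1) (p 2) + B.val (p 1) (p 2) * B.grad p i)
        * (C.val (p 1) (p 2))⁻¹
        + B.val (p 1) (p 2) * B.val (p 1) (p 2) * (-C.grad p i * (C.val (p 1) (p 2))⁻¹ ^ 2)
        - A.grad p i)
      (-(B.grad p i * (C.val (p 1) (p 2))⁻¹
        + B.val (p 1) (p 2) * (-C.grad p i * (C.val (p 1) (p 2))⁻¹ ^ 2))) b)
    (vec3 0 (-(B.grad p i * (C.val (p 1) (p 2))⁻¹
        + B.val (p 1) (p 2) * (-C.grad p i * (C.val (p 1) (p 2))⁻¹ ^ 2)))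
      (-C.grad p i * (C.val (p 1) (p 2))⁻¹ ^ 2) b)

/-! ### Calculus of coordinate partial derivatives. -/

/-- `u` has partial derivative `u'` in the `i`-th coordinate direction at `p`. -/
def HasPd (i : Fin 3) (u : Pt → ℝ) (u' : ℝ) (p : Pt) : Prop :=
  HasDerivAt (fun t : ℝ => u (Function.update p i t)) u' (p i)

theorem HasPd.pd {i : Fin 3} {u : Pt → ℝ} {u' : ℝ} {p : Pt} (h : HasPd i u u' p) :
    pd i u p = u' := HasDerivAt.deriv h

theorem HasPd.mul {i : Fin 3} {u v : Pt → ℝ} {u' v' : ℝ} {p : Pt} (hu : HasPd i u u' p)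
    (hv : HasPd i v v' p) : HasPd i (fun q => u q * v q) (u' * v p + u p * v') p := by
  simpa [HasPd] using HasDerivAt.fun_mul hu hv

theorem HasPd.add {i : Fin 3} {u v : Pt → ℝ} {u' v' : ℝ} {p : Pt} (hu : HasPd i u u' p)
    (hv : HasPd i v v' p) : HasPd i (fun q => u q + v q) (u' + v') p :=
  HasDerivAt.fun_add hu hv

theorem HasPd.sub {i : Fin 3} {u v : Pt → ℝ} {u' v' : ℝ} {p : Pt} (hu : HasPd i u u' p)
    (hv : HasPd i v v' p) : HasPd i (fun q => u q - v q) (u' - v') p :=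
  HasDerivAt.fun_sub hu hv

theorem HasPd.sum {ι : Type*} {s : Finset ι} {i : Fin 3} {u : ι → Pt → ℝ} {u' : ι → ℝ} {p : Pt}
    (hu : ∀ k ∈ s, HasPd i (u k) (u' k) p) :
    HasPd i (fun q => ∑ k ∈ s, u k q) (∑ k ∈ s, u' k) p :=
  HasDerivAt.fun_sum hu

theorem HasPd.const_mul {i : Fin 3} {u : Pt → ℝ} {u' : ℝ} {p : Pt} (c : ℝ) (hu : HasPd i u u' p) :
    HasPd i (fun q => c * u q) (c * u') p :=
  HasDerivAt.const_mul c hu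

theorem HasPd.neg {i : Fin 3} {u : Pt → ℝ} {u' : ℝ} {p : Pt} (hu : HasPd i u u' p) :
    HasPd i (fun q => -u q) (-u') p :=
  HasDerivAt.fun_neg hu

theorem HasPd.inv {i : Fin 3} {u : Pt → ℝ} {u' : ℝ} {p : Pt} (hu : HasPd i u u' p)
    (h0 : u p ≠ 0) : HasPd i (fun q => (u q)⁻¹) (-u' * (u p)⁻¹ ^ 2) p := by
  have h := HasDerivAt.fun_inv hu (by simpa using h0)
  simpa [HasPd, vec3, div_eq_mul_inv] using h

theorem hasPd_const (i : Fin 3) (c : ℝ) (p : Pt) : HasPd i (fun _ => c) 0 p :=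
  hasDerivAt_const _ _

/-- A function of the coordinates `r` and `x`, with derivatives in both directions. -/
theorem hasPd_of_plane {u ur ux : ℝ → ℝ → ℝ}
    (hr : ∀ r x, HasDerivAt (fun s => u s x) (ur r x) r)
    (hx : ∀ r x, HasDerivAt (fun s => u r s) (ux r x) x) (i : Fin 3) (p : Pt) :
    HasPd i (fun q => u (q 1) (q 2)) (vec3 0 (ur (p 1) (p 2)) (ux (p 1) (p 2)) i) p := by
  fin_cases i
  · simpa [HasPd, vec3, Function.update] using hasDerivAt_const (p 0) (u (p 1) (p 2))
  · simpa [HasPd, vec3, Function.update] using hr (p 1) (p 2)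
  · simpa [HasPd, vec3, Function.update] using hx (p 1) (p 2)

theorem HasPd.symEntry {u v w : Pt → ℝ} {u' v' w' : ℝ} {i : Fin 3} {p : Pt} (hu : HasPd i u u' p)
    (hv : HasPd i v v' p) (hw : HasPd i w w' p) (b c : Fin 3) :
    HasPd i (fun q => symEntry (u q) (v q) (w q) b c) (symEntry u' v' w' b c) p := by
  have h0 := hasPd_const i 0 p
  fin_cases b <;> fin_cases c
  exacts [hu, h0, hv, h0, h0, h0, hv, h0, hw]

namespace Jet.Holonomic

variable {A B C : Jet}

theorem hasPd_val (hA : A.Holonomic) (i : Fin 3) (p : Pt) :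
    HasPd i (fun q => A.val (q 1) (q 2)) (A.grad p i) p :=
  hasPd_of_plane hA.val_r hA.val_x i p

theorem hasPd_grad (hA : A.Holonomic) (i j : Fin 3) (p : Pt) :
    HasPd i (fun q => A.grad q j) (A.hess p i j) p := by
  fin_cases j
  exacts [hasPd_const i 0 p, hasPd_of_plane hA.dr_r hA.dr_x i p,
    hasPd_of_plane hA.dx_r hA.dx_x i p]

theorem hasPd_jetMetric (hA : A.Holonomic) (hB : B.Holonomic) (hC : C.Holonomic)
    (i b c : Fin 3) (p : Pt) :
    HasPd i (fun q => jetMetric A B C q b c) (jetMetricDeriv A B C i p b c) p := by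
  have h0 := hasPd_const i 0 p
  have h1 := hasPd_const i 1 p
  have hA' := hA.hasPd_val i p
  have hB' := hB.hasPd_val i p
  have hC' := hC.hasPd_val i p
  fin_cases b <;> fin_cases c
  exacts [hA', h1, hB', h1, h0, h0, hB', h0, hC']

theorem hasPd_jetMetricDeriv (hA : A.Holonomic) (hB : B.Holonomic) (hC : C.Holonomic)
    (i j b c : Fin 3) (p : Pt) :
    HasPd i (fun q => jetMetricDeriv A B C j q b c) (jetMetricDeriv2 A B C i j p b c) p :=
  (hA.hasPd_grad i j p).symEntry (hB.hasPd_grad i j p) (hC.hasPd_grad i j p) b c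

theorem hasPd_jetInv (hA : A.Holonomic) (hB : B.Holonomic) (hC : C.Holonomic) (i b c : Fin 3)
    (p : Pt) (h : C.val (p 1) (p 2) ≠ 0) :
    HasPd i (fun q => jetInv A B C q b c) (jetInvDeriv A B C i p b c) p := by
  have h0 := hasPd_const i 0 p
  have h1 := hasPd_const i 1 p
  have hw := (hC.hasPd_val i p).inv h
  have hB' := hB.hasPd_val i p
  have hBw := (hB'.mul hw).neg
  have hrr := ((hB'.mul hB').mul hw).sub (hA.hasPd_val i p)
  fin_cases b <;> fin_cases c
  exacts [h0, h1, h0, h1, hrr, hBw, h0, hBw, hw]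

end Jet.Holonomic

theorem jetMetric_inv {A B C : Jet} {p : Pt} (h : C.val (p 1) (p 2) ≠ 0) :
    (jetMetric A B C p)⁻¹ = Matrix.of (jetInv A B C p) := by
  apply Matrix.inv_eq_right_inv
  ext i j
  fin_cases i <;> fin_cases j <;>
    simp [jetMetric, jetInv, vec3, Matrix.mul_apply, Fin.sum_univ_three, h]
  all_goals field_simp
  all_goals ring

/-! ### Christoffel symbols and Ricci tensor of the ansatz. -/

/-- The Christoffel symbols of `jetMetric A B C`. -/
def jetChristoffel (A B C : Jet) (a b c : Fin 3) (p : Pt) : ℝ :=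
  (1 / 2) * ∑ d, jetInv A B C p a d *
    (jetMetricDeriv A B C b p d c + jetMetricDeriv A B C c p d b - jetMetricDeriv A B C d p b c)

/-- The first derivatives of the Christoffel symbols of `jetMetric A B C`. -/
def jetChristoffelDeriv (A B C : Jet) (e a b c : Fin 3) (p : Pt) : ℝ :=
  (1 / 2) * ∑ d, (jetInvDeriv A B C e p a d *
    (jetMetricDeriv A B C b p d c + jetMetricDeriv A B C c p d b - jetMetricDeriv A B C d p b c)
    + jetInv A B C p a d * (jetMetricDeriv2 A B C e b p d c + jetMetricDeriv2 A B C e c p d b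
      - jetMetricDeriv2 A B C e d p b c))

theorem christoffel_jetMetric {A B C : Jet} (hA : A.Holonomic)
    (hB : B.Holonomic) (hC : C.Holonomic) (a b c : Fin 3) {p : Pt} (h : C.val (p 1) (p 2) ≠ 0) :
    christoffel (jetMetric A B C) a b c p = jetChristoffel A B C a b c p := by
  simp only [christoffel, jetChristoffel, jetMetric_inv h, Matrix.of_apply,
    (Jet.Holonomic.hasPd_jetMetric hA hB hC _ _ _ p).pd]

theorem hasPd_jetChristoffel {A B C : Jet} (hA : A.Holonomic)
    (hB : B.Holonomic) (hC : C.Holonomic) (e a b c : Fin 3) {p : Pt} (h : C.val (p 1) (p 2) ≠ 0) :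
    HasPd e (jetChristoffel A B C a b c) (jetChristoffelDeriv A B C e a b c p) p := by
  refine HasPd.const_mul _ (HasPd.sum fun d _ => HasPd.mul (hA.hasPd_jetInv hB hC _ _ _ p h) ?_)
  exact ((hA.hasPd_jetMetricDeriv hB hC _ _ _ _ p).add
    (hA.hasPd_jetMetricDeriv hB hC _ _ _ _ p)).sub (hA.hasPd_jetMetricDeriv hB hC _ _ _ _ p)

/-- The closed formula for the Christoffel symbols is known only where `C ≠ 0`. Continuity of `C`
along the coordinate line makes it valid near the point, which is enough to differentiate it. -/
theorem pd_christoffel_jetMetric {A B C : Jet} (hA : A.Holonomic)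
    (hB : B.Holonomic) (hC : C.Holonomic) (e a b c : Fin 3) {p : Pt} (h : C.val (p 1) (p 2) ≠ 0) :
    pd e (christoffel (jetMetric A B C) a b c) p = jetChristoffelDeriv A B C e a b c p := by
  apply HasPd.pd
  refine HasDerivAt.congr_of_eventuallyEq (hasPd_jetChristoffel hA hB hC e a b c h) ?_
  have hc : ContinuousAt (fun t : ℝ => C.val (Function.update p e t 1) (Function.update p e t 2))
      (p e) := (hC.hasPd_val e p).continuousAt
  filter_upwards [hc.eventually_ne (by simpa using h)] with t ht
  exact christoffel_jetMetric hA hB hC a b c ht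

theorem ricci_jetMetric_eq_sum {A B C : Jet} (hA : A.Holonomic)
    (hB : B.Holonomic) (hC : C.Holonomic) (b c : Fin 3) {p : Pt} (h : C.val (p 1) (p 2) ≠ 0) :
    ricci (jetMetric A B C) b c p =
      ∑ a, (jetChristoffelDeriv A B C a a b c p - jetChristoffelDeriv A B C c a b a p)
      + ∑ a, ∑ d, (jetChristoffel A B C a a d p * jetChristoffel A B C d b c p
        - jetChristoffel A B C a c d p * jetChristoffel A B C d b a p) := by
  simp only [ricci, pd_christoffel_jetMetric hA hB hC _ _ _ _ h,
    christoffel_jetMetric hA hB hC _ _ _ h]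

/-- The values of the Christoffel symbols of `jetMetric a b c`. -/
def jetChristoffelTable (a b c : Jet) (p : Pt) (k i j : Fin 3) : ℝ :=
  let A := a.val (p 1) (p 2)
  let Ar := a.dr (p 1) (p 2)
  let Ax := a.dx (p 1) (p 2)
  let B := b.val (p 1) (p 2)
  let Br := b.dr (p 1) (p 2)
  let Bx := b.dx (p 1) (p 2)
  let Cr := c.dr (p 1) (p 2)
  let Cx := c.dx (p 1) (p 2)
  let w := (c.val (p 1) (p 2))⁻¹
  vec3
    (vec3 (vec3 (-(1 / 2) * Ar)
        0
        (-(1 / 2) * Br) j)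
      (vec3 0
        0
        0 j)
      (vec3 (-(1 / 2) * Br)
        0
        (-(1 / 2) * Cr) j) i)
    (vec3 (vec3 ((1 / 2) * A * Ar - (1 / 2) * Ar * B ^ 2 * w + (1 / 2) * Ax * B * w)
        ((1 / 2) * Ar - (1 / 2) * B * Br * w)
        ((1 / 2) * Ax + (1 / 2) * A * Br - (1 / 2) * B ^ 2 * Br * w) j)
      (vec3 ((1 / 2) * Ar - (1 / 2) * B * Br * w)
        0
        ((1 / 2) * Br - (1 / 2) * B * Cr * w) j)
      (vec3 ((1 / 2) * Ax + (1 / 2) * A * Br - (1 / 2) * B ^ 2 * Br * w)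
        ((1 / 2) * Br - (1 / 2) * B * Cr * w)
        (Bx + (1 / 2) * A * Cr - (1 / 2) * B * Cx * w - (1 / 2) * B ^ 2 * Cr * w) j) i)
    (vec3 (vec3 (-(1 / 2) * Ax * w + (1 / 2) * Ar * B * w)
        ((1 / 2) * Br * w)
        ((1 / 2) * B * Br * w) j)
      (vec3 ((1 / 2) * Br * w)
        0
        ((1 / 2) * Cr * w) j)
      (vec3 ((1 / 2) * B * Br * w)
        ((1 / 2) * Cr * w)
        ((1 / 2) * Cx * w + (1 / 2) * B * Cr * w) j) i) k

/-- The simplified entries keep the quadratic terms of the Ricci tensor within reach of `ring`. -/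
theorem jetChristoffel_eq_table (A B C : Jet) (a b c : Fin 3) (p : Pt) :
    jetChristoffel A B C a b c p = jetChristoffelTable A B C p a b c := by
  fin_cases a <;> fin_cases b <;> fin_cases c <;>
    simp only [jetChristoffel, jetChristoffelTable, jetInv, jetMetricDeriv, Jet.grad, symEntry,
      Fin.sum_univ_three, Fin.zero_eta, Fin.mk_one, Fin.reduceFinMk, vec3_zero, vec3_one,
      vec3_two] <;> ring

/-- The Ricci tensor of `jetMetric a b c`. -/
def jetRicci (a b c : Jet) (p : Pt) (i j : Fin 3) : ℝ :=
  let A := a.val (p 1) (p 2)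
  let Ar := a.dr (p 1) (p 2)
  let Arr := a.drr (p 1) (p 2)
  let Arx := a.drx (p 1) (p 2)
  let Ax := a.dx (p 1) (p 2)
  let Axx := a.dxx (p 1) (p 2)
  let B := b.val (p 1) (p 2)
  let Br := b.dr (p 1) (p 2)
  let Brr := b.drr (p 1) (p 2)
  let Brx := b.drx (p 1) (p 2)
  let Bx := b.dx (p 1) (p 2)
  let Cr := c.dr (p 1) (p 2)
  let Crr := c.drr (p 1) (p 2)
  let Cx := c.dx (p 1) (p 2)
  let w := (c.val (p 1) (p 2))⁻¹
  vec3 (vec3 ((1 / 2) * A * Arr - (1 / 2) * Axx * w - (1 / 2) * A * Br ^ 2 * w +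
         (1 / 2) * Ar * Bx * w - (1 / 2) * Arr * B ^ 2 * w + Arx * B * w - (1 / 2) * Ax * Br * w
         + (1 / 4) * Ax * Cx * w ^ 2 + (1 / 4) * A * Ar * Cr * w - (1 / 4) * Ar * B * Cx * w ^ 2
         + (1 / 4) * Ar * B ^ 2 * Cr * w ^ 2 - (1 / 4) * Ax * B * Cr * w ^ 2)
      ((1 / 2) * Arr - (1 / 2) * Br ^ 2 * w + (1 / 2) * Brx * w + (1 / 4) * Ar * Cr * w -
         (1 / 2) * B * Brr * w - (1 / 4) * Br * Cx * w ^ 2 + (1 / 4) * B * Br * Cr * w ^ 2)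
      ((1 / 2) * Arx + (1 / 2) * A * Brr - (1 / 4) * Ax * Cr * w - (1 / 2) * B * Br ^ 2 * w +
         (1 / 2) * B * Brx * w - (1 / 2) * B ^ 2 * Brr * w - (1 / 4) * A * Br * Cr * w +
         (1 / 2) * Ar * B * Cr * w - (1 / 4) * B * Br * Cx * w ^ 2 +
         (1 / 4) * B ^ 2 * Br * Cr * w ^ 2) j)
    (vec3 ((1 / 2) * Arr - (1 / 2) * Br ^ 2 * w + (1 / 2) * Brx * w + (1 / 4) * Ar * Cr * w -
         (1 / 2) * B * Brr * w - (1 / 4) * Br * Cx * w ^ 2 + (1 / 4) * B * Br * Cr * w ^ 2)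
      ((1 / 4) * Cr ^ 2 * w ^ 2 - (1 / 2) * Crr * w)
      ((1 / 2) * Brr + (1 / 4) * B * Cr ^ 2 * w ^ 2 - (1 / 2) * B * Crr * w -
         (1 / 4) * Br * Cr * w) j)
    (vec3 ((1 / 2) * Arx + (1 / 2) * A * Brr - (1 / 4) * Ax * Cr * w - (1 / 2) * B * Br ^ 2 * w +
         (1 / 2) * B * Brx * w - (1 / 2) * B ^ 2 * Brr * w - (1 / 4) * A * Br * Cr * w +
         (1 / 2) * Ar * B * Cr * w - (1 / 4) * B * Br * Cx * w ^ 2 +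
         (1 / 4) * B ^ 2 * Br * Cr * w ^ 2)
      ((1 / 2) * Brr + (1 / 4) * B * Cr ^ 2 * w ^ 2 - (1 / 2) * B * Crr * w -
         (1 / 4) * Br * Cr * w)
      (-(1 / 2) * Br ^ 2 + Brx + (1 / 2) * A * Crr + (1 / 2) * Ar * Cr -
         (1 / 4) * A * Cr ^ 2 * w + (1 / 4) * B ^ 2 * Cr ^ 2 * w ^ 2 - (1 / 2) * B ^ 2 * Crr * w
         - (1 / 2) * Br * Cx * w) j) i

/-- With `w = 1 / C` as a separate variable, whose derivative is `-C' w²`, both sides are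
polynomials; `C` itself never occurs, so no cancellation of `C` against `w` is needed. -/
theorem ricci_jetMetric {A B C : Jet} (hA : A.Holonomic) (hB : B.Holonomic) (hC : C.Holonomic)
    (b c : Fin 3) {p : Pt} (h : C.val (p 1) (p 2) ≠ 0) :
    ricci (jetMetric A B C) b c p = jetRicci A B C p b c := by
  rw [ricci_jetMetric_eq_sum hA hB hC b c h]
  fin_cases b <;> fin_cases c <;>
    simp only [jetChristoffel_eq_table, jetChristoffelTable, jetChristoffelDeriv, jetRicci, jetInv,
      jetInvDeriv, jetMetricDeriv, jetMetricDeriv2, Jet.grad, Jet.hess, symEntry,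
      Fin.sum_univ_three, Fin.zero_eta, Fin.mk_one, Fin.reduceFinMk, vec3_zero, vec3_one, vec3_two,
      mul_zero, zero_mul, add_zero, zero_add, sub_zero, neg_zero] <;> ring

/-! ### The Maxwell field: source term, divergence and exterior derivative. -/

/-- The 2-form `P dv ∧ dr + W dv ∧ dx + Z dr ∧ dx`. -/
def jetForm (P W Z : Jet) : Tensor2 := fun p =>
  !![0, P.val (p 1) (p 2), W.val (p 1) (p 2);
     -P.val (p 1) (p 2), 0, Z.val (p 1) (p 2);
     -W.val (p 1) (p 2), -Z.val (p 1) (p 2), 0]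

/-- The components of the 2-form `a dv ∧ dr + b dv ∧ dx + c dr ∧ dx`. -/
def skewEntry (a b c : ℝ) (i j : Fin 3) : ℝ :=
  vec3 (vec3 0 a b j) (vec3 (-a) 0 c j) (vec3 (-b) (-c) 0 j) i

theorem jetForm_apply (P W Z : Jet) (p : Pt) (b c : Fin 3) : jetForm P W Z p b c =
    skewEntry (P.val (p 1) (p 2)) (W.val (p 1) (p 2)) (Z.val (p 1) (p 2)) b c := by
  fin_cases b <;> fin_cases c <;> rfl

theorem jetMetric_apply (A B C : Jet) (p : Pt) (b c : Fin 3) : jetMetric A B C p b c =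
    vec3 (vec3 (A.val (p 1) (p 2)) 1 (B.val (p 1) (p 2)) c) (vec3 1 0 0 c)
      (vec3 (B.val (p 1) (p 2)) 0 (C.val (p 1) (p 2)) c) b := by
  fin_cases b <;> fin_cases c <;> rfl

/-- The first derivatives of `jetForm P W Z`. -/
def jetFormDeriv (P W Z : Jet) (i : Fin 3) (p : Pt) (b c : Fin 3) : ℝ :=
  skewEntry (P.grad p i) (W.grad p i) (Z.grad p i) b c

theorem Jet.Holonomic.hasPd_jetForm {P W Z : Jet} (hP : P.Holonomic) (hW : W.Holonomic)
    (hZ : Z.Holonomic) (i b c : Fin 3) (p : Pt) :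
    HasPd i (fun q => jetForm P W Z q b c) (jetFormDeriv P W Z i p b c) p := by
  have h0 := hasPd_const i 0 p
  have hP' := hP.hasPd_val i p
  have hW' := hW.hasPd_val i p
  have hZ' := hZ.hasPd_val i p
  fin_cases b <;> fin_cases c
  exacts [h0, hP', hW', hP'.neg, h0, hZ', hW'.neg, hZ'.neg, h0]

/-- The Maxwell source `2 M_{bs} M_c^s - g_{bc} M_{rs} M^{rs}` of `jetForm ψ φ ζ`. -/
def jetSource (a b c ψ φ ζ : Jet) (p : Pt) (i j : Fin 3) : ℝ :=
  let A := a.val (p 1) (p 2)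
  let B := b.val (p 1) (p 2)
  let C := c.val (p 1) (p 2)
  let P := ψ.val (p 1) (p 2)
  let W := φ.val (p 1) (p 2)
  let Z := ζ.val (p 1) (p 2)
  let w := (c.val (p 1) (p 2))⁻¹
  vec3 (vec3 (2 * W ^ 2 * w + 2 * A ^ 2 * Z ^ 2 * w + 2 * B ^ 2 * P ^ 2 * w - 4 * A * W * Z * w -
         4 * B * P * W * w + 4 * A * B * P * Z * w)
      (2 * A * Z ^ 2 * w - 2 * W * Z * w + 2 * B * P * Z * w)
      (2 * B * P ^ 2 - 2 * P * W + 2 * A * P * Z + 2 * A * B * Z ^ 2 * w - 2 * B * W * Z * w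
         + 2 * B ^ 2 * P * Z * w) j)
    (vec3 (2 * A * Z ^ 2 * w - 2 * W * Z * w + 2 * B * P * Z * w)
      (2 * Z ^ 2 * w)
      (2 * P * Z + 2 * B * Z ^ 2 * w) j)
    (vec3 (2 * B * P ^ 2 - 2 * P * W + 2 * A * P * Z + 2 * A * B * Z ^ 2 * w - 2 * B * W * Z * w
         + 2 * B ^ 2 * P * Z * w)
      (2 * P * Z + 2 * B * Z ^ 2 * w)
      (2 * C * P ^ 2 + 4 * B * P * Z + 2 * B ^ 2 * Z ^ 2 * w) j) i

/-- Unlike the Ricci tensor, the trace term `g_{bc} M²` multiplies `1 / C` by `C`, so `C ≠ 0` is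
needed for the algebra as well. -/
theorem einsteinEq_jetMetric {A B C : Jet} (hA : A.Holonomic) (hB : B.Holonomic)
    (hC : C.Holonomic) (P W Z : Jet) (Λ : ℝ) (b c : Fin 3) {p : Pt}
    (h : C.val (p 1) (p 2) ≠ 0) :
    einsteinEq Λ (jetMetric A B C) (jetForm P W Z) b c p =
      jetRicci A B C p b c - (jetSource A B C P W Z p b c + Λ * jetMetric A B C p b c) := by
  rw [einsteinEq, ricci_jetMetric hA hB hC b c h]
  congr 2
  simp only [maxwellSq, maxwellNormSq, jetMetric_inv h, Matrix.of_apply, jetForm_apply,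
    jetMetric_apply, Fin.sum_univ_three]
  fin_cases b <;> fin_cases c <;>
    simp only [jetInv, skewEntry, jetSource, Fin.zero_eta, Fin.mk_one, Fin.reduceFinMk,
      vec3_zero, vec3_one, vec3_two, mul_zero, zero_mul, add_zero, zero_add, sub_zero,
      one_mul] <;> field_simp <;> ring

/-- The divergence of `jetForm ψ φ ζ` in the metric `jetMetric a b c`. -/
def jetMaxwell (a b c ψ φ ζ : Jet) (p : Pt) (i : Fin 3) : ℝ :=
  let A := a.val (p 1) (p 2)
  let Ar := a.dr (p 1) (p 2)
  let Ax := a.dx (p 1) (p 2)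
  let B := b.val (p 1) (p 2)
  let Br := b.dr (p 1) (p 2)
  let Bx := b.dx (p 1) (p 2)
  let Cr := c.dr (p 1) (p 2)
  let Cx := c.dx (p 1) (p 2)
  let P := ψ.val (p 1) (p 2)
  let Pr := ψ.dr (p 1) (p 2)
  let Px := ψ.dx (p 1) (p 2)
  let W := φ.val (p 1) (p 2)
  let Wr := φ.dr (p 1) (p 2)
  let Wx := φ.dx (p 1) (p 2)
  let Z := ζ.val (p 1) (p 2)
  let Zr := ζ.dr (p 1) (p 2)
  let Zx := ζ.dx (p 1) (p 2)
  let w := (c.val (p 1) (p 2))⁻¹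
  vec3 (A * Pr - Wx * w + Ax * Z * w + B * Px * w + B * Wr * w - B ^ 2 * Pr * w + Bx * P * w +
      (1 / 2) * Cx * W * w ^ 2 + A * Br * Z * w + (1 / 2) * A * Cr * P * w - Ar * B * Z * w -
      B * Br * P * w - (1 / 2) * B * Cr * W * w ^ 2 - (1 / 2) * B * Cx * P * w ^ 2 +
      (1 / 2) * B ^ 2 * Cr * P * w ^ 2)
    (Pr - Zx * w + B * Zr * w + Br * Z * w + (1 / 2) * Cr * P * w + (1 / 2) * Cx * Z * w ^ 2 -
      (1 / 2) * B * Cr * Z * w ^ 2)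
    (Wr - A * Zr - Ar * Z - Br * P - B * Zx * w + B ^ 2 * Zr * w - (1 / 2) * Cr * W * w +
      (1 / 2) * A * Cr * Z * w + B * Br * Z * w + B * Cr * P * w + (1 / 2) * B * Cx * Z * w ^ 2
      - (1 / 2) * B ^ 2 * Cr * Z * w ^ 2) i

theorem maxwellEq_jetMetric {A B C P W Z : Jet} (hA : A.Holonomic) (hB : B.Holonomic)
    (hC : C.Holonomic) (hP : P.Holonomic) (hW : W.Holonomic) (hZ : Z.Holonomic) (c : Fin 3)
    {p : Pt} (h : C.val (p 1) (p 2) ≠ 0) :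
    maxwellEq (jetMetric A B C) (jetForm P W Z) c p = jetMaxwell A B C P W Z p c := by
  simp only [maxwellEq, covDeriv, jetMetric_inv h, Matrix.of_apply,
    (hP.hasPd_jetForm hW hZ _ _ _ p).pd, christoffel_jetMetric hA hB hC _ _ _ h,
    jetChristoffel_eq_table, Fin.sum_univ_three]
  simp only [jetForm_apply]
  fin_cases c <;>
    simp only [jetInv, skewEntry, Jet.grad, jetFormDeriv, jetChristoffelTable, jetMaxwell,
      Fin.zero_eta, Fin.mk_one, Fin.reduceFinMk, vec3_zero, vec3_one, vec3_two, mul_zero, zero_mul,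
      add_zero, zero_add, sub_zero, neg_zero, one_mul] <;> ring

theorem extDeriv2_jetForm {P W Z : Jet} (hP : P.Holonomic) (hW : W.Holonomic) (hZ : Z.Holonomic) :
    (∀ a b c p, extDeriv2 (jetForm P W Z) a b c p = 0) ↔ ∀ r x, W.dr r x = P.dx r x := by
  simp only [extDeriv2, (hP.hasPd_jetForm hW hZ _ _ _ _).pd]
  constructor
  · intro h r x
    -- In dimension three a 3-form has one independent component; as nothing depends on `v`, it
    -- reads `P_x - W_r`.
    have := h 1 2 0 ![0, r, x]
    simp only [jetFormDeriv, skewEntry, Jet.grad, vec3_zero, vec3_one, vec3_two] at this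
    simp at this
    linarith
  · intro h a b c p
    have := h (p 1) (p 2)
    fin_cases a <;> fin_cases b <;> fin_cases c <;>
      simp [jetFormDeriv, skewEntry, Jet.grad, vec3, this]

/-! ### The horizon data and their perturbations as jets of monomials in `r`. -/

/-- The jet of `r ^ n * u x`. -/
def Jet.monomial (n : ℕ) (u : ℝ → ℝ) : Jet where
  val r x := r ^ n * u x
  -- Truncated subtraction in the exponents is harmless: whenever an exponent truncates, a factor
  -- `n` or `n - 1` vanishes.
  dr r x := n * r ^ (n - 1) * u x
  dx r x := r ^ n * deriv u x
  drr r x := n * ((n - 1 : ℕ) * r ^ (n - 1 - 1)) * u x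
  drx r x := n * r ^ (n - 1) * deriv u x
  dxx r x := r ^ n * deriv (deriv u) x

/-- The jet of `A + ε B`. -/
def Jet.perturb (A B : Jet) (ε : ℝ) : Jet where
  val r x := A.val r x + ε * B.val r x
  dr r x := A.dr r x + ε * B.dr r x
  dx r x := A.dx r x + ε * B.dx r x
  drr r x := A.drr r x + ε * B.drr r x
  drx r x := A.drx r x + ε * B.drx r x
  dxx r x := A.dxx r x + ε * B.dxx r x

theorem Jet.Holonomic.perturb {A B : Jet} (hA : A.Holonomic) (hB : B.Holonomic) (ε : ℝ) :
    (A.perturb B ε).Holonomic where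
  val_r r x := (hA.val_r r x).add ((hB.val_r r x).const_mul ε)
  val_x r x := (hA.val_x r x).add ((hB.val_x r x).const_mul ε)
  dr_r r x := (hA.dr_r r x).add ((hB.dr_r r x).const_mul ε)
  dr_x r x := (hA.dr_x r x).add ((hB.dr_x r x).const_mul ε)
  dx_r r x := (hA.dx_r r x).add ((hB.dx_r r x).const_mul ε)
  dx_x r x := (hA.dx_x r x).add ((hB.dx_x r x).const_mul ε)

theorem Jet.holonomic_monomial (n : ℕ) {u : ℝ → ℝ} (hu : ContDiff ℝ ∞ u) :
    (Jet.monomial n u).Holonomic where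
  val_r r x := (hasDerivAt_pow n r).mul_const (u x)
  val_x r x := ((hu.differentiable (by simp)) x).hasDerivAt.const_mul (r ^ n)
  dr_r r x := ((hasDerivAt_pow (n - 1) r).const_mul (n : ℝ)).mul_const (u x)
  dr_x r x := ((hu.differentiable (by simp)) x).hasDerivAt.const_mul (n * r ^ (n - 1))
  dx_r r x := (hasDerivAt_pow n r).mul_const (deriv u x)
  dx_x r x := (((contDiff_infty_iff_deriv.1 hu).2.differentiable (by simp)) x).hasDerivAt.const_mul
    (r ^ n)

/-- The `dv²` component of `g⁽⁰⁾ + ε g⁽¹⁾`, as a function of `ε`. -/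
def jetA (H : HorizonData) (d : FirstOrderData) : ℝ → Jet :=
  (Jet.monomial 2 H.F).perturb (Jet.monomial 3 d.F)

/-- The `dv dx` component of `g⁽⁰⁾ + ε g⁽¹⁾`, as a function of `ε`. -/
def jetB (H : HorizonData) (d : FirstOrderData) : ℝ → Jet :=
  (Jet.monomial 1 H.h).perturb (Jet.monomial 2 d.h)

/-- The `dx²` component of `g⁽⁰⁾ + ε g⁽¹⁾`, as a function of `ε`. -/
def jetC (d : FirstOrderData) : ℝ → Jet :=
  (Jet.monomial 0 fun _ => 1).perturb (Jet.monomial 1 d.γ)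

/-- The `dv ∧ dr` component of the perturbed Maxwell field, as a function of `ε`. -/
def jetP (H : HorizonData) (d : FirstOrderData) : ℝ → Jet :=
  (Jet.monomial 0 H.Ψ).perturb (Jet.monomial 1 d.Ψ)

/-- The `dv ∧ dx` component of the perturbed Maxwell field, as a function of `ε`. -/
def jetW (H : HorizonData) (d : FirstOrderData) : ℝ → Jet :=
  (Jet.monomial 1 H.W).perturb (Jet.monomial 2 d.W)

/-- The `dr ∧ dx` component of the perturbed Maxwell field, as a function of `ε`. -/
def jetZ (d : FirstOrderData) : ℝ → Jet :=
  (Jet.monomial 0 fun _ => 0).perturb (Jet.monomial 0 d.Z)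

/-- The ansatz is linear in its coefficients, so the whole family in `ε` stays inside it and the
tables apply for each `ε`. -/
theorem metric_add_smul (H : HorizonData) (d : FirstOrderData) (ε : ℝ) :
    (fun q => H.metric q + ε • d.metric q) = jetMetric (jetA H d ε) (jetB H d ε) (jetC d ε) := by
  funext q
  ext i j
  fin_cases i <;> fin_cases j <;>
    simp [HorizonData.metric, FirstOrderData.metric, jetMetric, jetA, jetB, jetC, Jet.perturb,
      Jet.monomial]

theorem maxwell_add_smul (H : HorizonData) (d : FirstOrderData) (ε : ℝ) :
    (fun q => H.maxwell q + ε • d.maxwell q) = jetForm (jetP H d ε) (jetW H d ε) (jetZ d ε) := by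
  funext q
  ext i j
  fin_cases i <;> fin_cases j <;>
    simp [HorizonData.maxwell, FirstOrderData.maxwell, jetForm, jetP, jetW, jetZ, Jet.perturb,
      Jet.monomial] <;> ring

/-- All functions of the horizon data are smooth. -/
structure HorizonData.Smooth (H : HorizonData) : Prop where
  F : ContDiff ℝ ∞ H.F
  h : ContDiff ℝ ∞ H.h
  Ψ : ContDiff ℝ ∞ H.Ψ
  W : ContDiff ℝ ∞ H.W

/-- All functions of the first order metric data are smooth. -/
structure FirstOrderData.MetricSmooth (d : FirstOrderData) : Prop where
  F : ContDiff ℝ ∞ d.F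
  h : ContDiff ℝ ∞ d.h
  γ : ContDiff ℝ ∞ d.γ

/-- All functions of the first order data are smooth. -/
structure FirstOrderData.Smooth (d : FirstOrderData) : Prop extends d.MetricSmooth where
  Ψ : ContDiff ℝ ∞ d.Ψ
  W : ContDiff ℝ ∞ d.W
  Z : ContDiff ℝ ∞ d.Z

section

variable {H : HorizonData} {d : FirstOrderData}

theorem holonomic_jetA (hH : H.Smooth) (hd : d.MetricSmooth) (ε : ℝ) : (jetA H d ε).Holonomic :=
  (Jet.holonomic_monomial 2 hH.F).perturb (Jet.holonomic_monomial 3 hd.F) ε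

theorem holonomic_jetB (hH : H.Smooth) (hd : d.MetricSmooth) (ε : ℝ) : (jetB H d ε).Holonomic :=
  (Jet.holonomic_monomial 1 hH.h).perturb (Jet.holonomic_monomial 2 hd.h) ε

theorem holonomic_jetC (hd : d.MetricSmooth) (ε : ℝ) : (jetC d ε).Holonomic :=
  (Jet.holonomic_monomial 0 contDiff_const).perturb (Jet.holonomic_monomial 1 hd.γ) ε

theorem holonomic_jetP (hH : H.Smooth) (hd : d.Smooth) (ε : ℝ) : (jetP H d ε).Holonomic :=
  (Jet.holonomic_monomial 0 hH.Ψ).perturb (Jet.holonomic_monomial 1 hd.Ψ) ε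

theorem holonomic_jetW (hH : H.Smooth) (hd : d.Smooth) (ε : ℝ) : (jetW H d ε).Holonomic :=
  (Jet.holonomic_monomial 1 hH.W).perturb (Jet.holonomic_monomial 2 hd.W) ε

theorem holonomic_jetZ (hd : d.Smooth) (ε : ℝ) : (jetZ d ε).Holonomic :=
  (Jet.holonomic_monomial 0 contDiff_const).perturb (Jet.holonomic_monomial 0 hd.Z) ε

theorem jetC_val (d : FirstOrderData) (ε r x : ℝ) : (jetC d ε).val r x = 1 + ε * (r * d.γ x) := by
  simp [jetC, Jet.perturb, Jet.monomial]

/-- The perturbed metric degenerates where `1 + ε r γ = 0`. At a fixed point this is excluded for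
small `ε`, which suffices for a derivative at `ε = 0`. -/
theorem eventually_jetC_ne_zero (d : FirstOrderData) (r x : ℝ) :
    ∀ᶠ ε in nhds (0 : ℝ), (jetC d ε).val r x ≠ 0 := by
  simp only [jetC_val]
  have hc : ContinuousAt (fun ε : ℝ => 1 + ε * (r * d.γ x)) 0 := by fun_prop
  exact hc.eventually_ne (by simp)

theorem ricci_eventuallyEq (hH : H.Smooth) (hd : d.MetricSmooth) (b c : Fin 3) (p : Pt) :
    (fun ε : ℝ => ricci (fun q => H.metric q + ε • d.metric q) b c p)
      =ᶠ[nhds 0] fun ε => jetRicci (jetA H d ε) (jetB H d ε) (jetC d ε) p b c := by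
  filter_upwards [eventually_jetC_ne_zero d (p 1) (p 2)] with ε hε
  rw [metric_add_smul]
  exact ricci_jetMetric (holonomic_jetA hH hd ε) (holonomic_jetB hH hd ε) (holonomic_jetC hd ε)
    b c hε

theorem einsteinEq_eventuallyEq (Λ : ℝ) (hH : H.Smooth) (hd : d.Smooth) (b c : Fin 3) (p : Pt) :
    (fun ε : ℝ => einsteinEq Λ (fun q => H.metric q + ε • d.metric q)
      (fun q => H.maxwell q + ε • d.maxwell q) b c p) =ᶠ[nhds 0]
      fun ε => (jetRicci (jetA H d ε) (jetB H d ε) (jetC d ε) p b c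
        - Λ * (H.metric p + ε • d.metric p) b c)
        - jetSource (jetA H d ε) (jetB H d ε) (jetC d ε) (jetP H d ε) (jetW H d ε) (jetZ d ε)
          p b c := by
  filter_upwards [eventually_jetC_ne_zero d (p 1) (p 2)] with ε hε
  have hm := congrFun (metric_add_smul H d ε) p
  rw [metric_add_smul, maxwell_add_smul, einsteinEq_jetMetric (holonomic_jetA hH hd.1 ε)
    (holonomic_jetB hH hd.1 ε) (holonomic_jetC hd.1 ε) _ _ _ _ _ _ hε, ← hm]
  ring

theorem maxwellEq_eventuallyEq (hH : H.Smooth) (hd : d.Smooth) (c : Fin 3) (p : Pt) :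
    (fun ε : ℝ => maxwellEq (fun q => H.metric q + ε • d.metric q)
      (fun q => H.maxwell q + ε • d.maxwell q) c p) =ᶠ[nhds 0]
      fun ε => jetMaxwell (jetA H d ε) (jetB H d ε) (jetC d ε) (jetP H d ε) (jetW H d ε)
        (jetZ d ε) p c := by
  filter_upwards [eventually_jetC_ne_zero d (p 1) (p 2)] with ε hε
  rw [metric_add_smul, maxwell_add_smul, maxwellEq_jetMetric (holonomic_jetA hH hd.1 ε)
    (holonomic_jetB hH hd.1 ε) (holonomic_jetC hd.1 ε) (holonomic_jetP hH hd ε)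
    (holonomic_jetW hH hd ε) (holonomic_jetZ hd ε) _ hε]

end

/-! ### Linearisation at horizons with constant data. -/

/-- Horizon data with constant `F⁽⁰⁾ = f`, `h⁽⁰⁾ = h`, `Ψ⁽⁰⁾ = ψ` and `W⁽⁰⁾ = 0`. -/
def constHorizon (f h ψ : ℝ) : HorizonData where
  F := fun _ => f
  h := fun _ => h
  Ψ := fun _ => ψ
  W := fun _ => 0

theorem smooth_constHorizon (f h ψ : ℝ) : (constHorizon f h ψ).Smooth :=
  ⟨contDiff_const, contDiff_const, contDiff_const, contDiff_const⟩

/-- The linearisation of `R_{ij} - Λ g_{ij}` at `constHorizon f h ψ`. -/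
def linVacuum (Λ f h : ℝ) (d : FirstOrderData) (r x : ℝ) (i j : Fin 3) : ℝ :=
  let F := d.F x
  let k := d.h x
  let γ := d.γ x
  let F' := deriv d.F x
  let F'' := deriv (deriv d.F) x
  let k' := deriv d.h x
  let γ' := deriv d.γ x
  let E₀₀ := r ^ 3 * (-(1 / 2) * F'' + (4 * f - (7 / 2) * h ^ 2 - Λ) * F + (5 / 2) * h * F'
    + f * k' + (1 / 2) * f ^ 2 * γ - 4 * f * h * k - (1 / 2) * f * h * γ' + 2 * f * h ^ 2 * γ)
  let E₀₁ := r * (3 * F + k' + (1 / 2) * f * γ - 3 * h * k - (1 / 4) * h * γ' + (3 / 4) * h ^ 2 * γ)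
  let E₀₂ := r ^ 2 * ((3 / 2) * F' + (f - (7 / 2) * h ^ 2 - Λ) * k + h * k' - (1 / 4) * h ^ 2 * γ'
    + (3 / 4) * h ^ 3 * γ + (3 / 4) * f * h * γ)
  let E₁₂ := k - (1 / 4) * h * γ
  let E₂₂ := r * (2 * k' + (f - Λ) * γ - 2 * h * k - (1 / 2) * h * γ')
  vec3 (vec3 E₀₀ E₀₁ E₀₂ j) (vec3 E₀₁ 0 E₁₂ j) (vec3 E₀₂ E₁₂ E₂₂ j) i

/-- The linearisation of the Maxwell source at `constHorizon f h ψ`. -/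
def linSource (f h ψ : ℝ) (d : FirstOrderData) (r x : ℝ) (i j : Fin 3) : ℝ :=
  let k := d.h x
  let γ := d.γ x
  let Ψ := d.Ψ x
  let W := d.W x
  let Z := d.Z x
  let E₀₀ := r ^ 3 * (-(4 * h * ψ * W) + 4 * h * ψ ^ 2 * k + 4 * h ^ 2 * ψ * Ψ
    - 2 * h ^ 2 * ψ ^ 2 * γ + 4 * f * h * ψ * Z)
  let E₀₁ := r * (2 * h * ψ * Z)
  let E₀₂ := r ^ 2 * (-(2 * ψ * W) + 2 * ψ ^ 2 * k + 2 * (f + h ^ 2) * ψ * Z + 4 * h * ψ * Ψ)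
  let E₁₂ := 2 * ψ * Z
  let E₂₂ := r * (4 * ψ * Ψ + 2 * ψ ^ 2 * γ + 4 * h * ψ * Z)
  vec3 (vec3 E₀₀ E₀₁ E₀₂ j) (vec3 E₀₁ 0 E₁₂ j) (vec3 E₀₂ E₁₂ E₂₂ j) i

/-- The linearisation of the Maxwell equation at `constHorizon f h ψ`. -/
def linMaxwell (f h ψ : ℝ) (d : FirstOrderData) (r x : ℝ) (i : Fin 3) : ℝ :=
  let k := d.h x
  let γ := d.γ x
  let Ψ := d.Ψ x
  let W := d.W x
  let Z := d.Z x
  let k' := deriv d.h x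
  let γ' := deriv d.γ x
  let Ψ' := deriv d.Ψ x
  let W' := deriv d.W x
  let Z' := deriv d.Z x
  vec3 (r ^ 2 * (-W' + 2 * h * W + (f - 2 * h ^ 2) * Ψ + h * Ψ' + ψ * k' - f * h * Z
      + (1 / 2) * f * ψ * γ - 3 * h * ψ * k - (1 / 2) * h * ψ * γ' + (3 / 2) * h ^ 2 * ψ * γ))
    (-Z' + Ψ + h * Z + (1 / 2) * ψ * γ)
    (r * (2 * W + (h ^ 2 - 2 * f) * Z - h * Z' - h * Ψ - 2 * ψ * k + h * ψ * γ)) i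

theorem hasDerivAt_linear (a b : ℝ) : HasDerivAt (fun ε : ℝ => a + ε * b) b 0 := by
  simpa using ((hasDerivAt_id (0 : ℝ)).mul_const b).const_add a

-- Every entry is built by ring operations from functions affine in `ε` and the inverse of one such
-- function, so the differentiation rules apply mechanically and `ring` compares the outcome with
-- the table.
set_option maxHeartbeats 1000000 in
theorem hasDerivAt_jetRicci (Λ f h ψ : ℝ) (d : FirstOrderData) (b c : Fin 3) (p : Pt) :
    HasDerivAt (fun ε : ℝ => jetRicci (jetA (constHorizon f h ψ) d ε)
      (jetB (constHorizon f h ψ) d ε) (jetC d ε) p b c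
        - Λ * ((constHorizon f h ψ).metric p + ε • d.metric p) b c)
      (linVacuum Λ f h d (p 1) (p 2) b c) 0 := by
  simp only [congrFun (metric_add_smul _ d _) p, jetMetric_apply]
  fin_cases b <;> fin_cases c <;>
    simp only [jetRicci, linVacuum, Fin.zero_eta, Fin.mk_one, Fin.reduceFinMk, vec3_zero, vec3_one,
      vec3_two, jetA, jetB, jetC, Jet.perturb]
  all_goals
    apply HasDerivAt.congr_deriv
    · repeat' first
        | exact hasDerivAt_const _ _
        | exact hasDerivAt_linear _ _
        | apply HasDerivAt.fun_pow
        | apply HasDerivAt.fun_sub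
        | apply HasDerivAt.fun_add
        | apply HasDerivAt.fun_mul
        | apply HasDerivAt.fun_inv (hasDerivAt_linear _ _)
      -- What is left is `C ≠ 0` at `ε = 0`, where `C = 1`.
      all_goals simp [Jet.monomial]
    · simp [Jet.monomial, constHorizon] <;> ring

set_option maxHeartbeats 1000000 in
theorem hasDerivAt_jetSource (f h ψ : ℝ) (d : FirstOrderData) (b c : Fin 3) (p : Pt) :
    HasDerivAt (fun ε : ℝ => jetSource (jetA (constHorizon f h ψ) d ε)
      (jetB (constHorizon f h ψ) d ε) (jetC d ε) (jetP (constHorizon f h ψ) d ε)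
      (jetW (constHorizon f h ψ) d ε) (jetZ d ε) p b c)
      (linSource f h ψ d (p 1) (p 2) b c) 0 := by
  fin_cases b <;> fin_cases c <;>
    simp only [jetSource, linSource, Fin.zero_eta, Fin.mk_one, Fin.reduceFinMk, vec3_zero,
      vec3_one, vec3_two, jetA, jetB, jetC, jetP, jetW, jetZ, Jet.perturb]
  all_goals
    apply HasDerivAt.congr_deriv
    · repeat' first
        | exact hasDerivAt_const _ _
        | exact hasDerivAt_linear _ _
        | apply HasDerivAt.fun_pow
        | apply HasDerivAt.fun_sub
        | apply HasDerivAt.fun_add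
        | apply HasDerivAt.fun_mul
        | apply HasDerivAt.fun_inv (hasDerivAt_linear _ _)
      all_goals simp [Jet.monomial]
    · simp [Jet.monomial, constHorizon] <;> ring

set_option maxHeartbeats 1000000 in
theorem hasDerivAt_jetMaxwell (f h ψ : ℝ) (d : FirstOrderData) (c : Fin 3) (p : Pt) :
    HasDerivAt (fun ε : ℝ => jetMaxwell (jetA (constHorizon f h ψ) d ε)
      (jetB (constHorizon f h ψ) d ε) (jetC d ε) (jetP (constHorizon f h ψ) d ε)
      (jetW (constHorizon f h ψ) d ε) (jetZ d ε) p c)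
      (linMaxwell f h ψ d (p 1) (p 2) c) 0 := by
  fin_cases c <;>
    simp only [jetMaxwell, linMaxwell, Fin.zero_eta, Fin.mk_one, Fin.reduceFinMk, vec3_zero,
      vec3_one, vec3_two, jetA, jetB, jetC, jetP, jetW, jetZ, Jet.perturb]
  all_goals
    apply HasDerivAt.congr_deriv
    · repeat' first
        | exact hasDerivAt_const _ _
        | exact hasDerivAt_linear _ _
        | apply HasDerivAt.fun_pow
        | apply HasDerivAt.fun_sub
        | apply HasDerivAt.fun_add
        | apply HasDerivAt.fun_mul
        | apply HasDerivAt.fun_inv (hasDerivAt_linear _ _)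
      all_goals simp [Jet.monomial]
    · simp [Jet.monomial, constHorizon]
      ring

/-- By uniqueness of derivatives, each linearised equation becomes the vanishing of an explicit
expression. -/
theorem hasDerivAt_iff_of_hasDerivAt {u v : ℝ → ℝ} {v' : ℝ} (huv : u =ᶠ[nhds 0] v)
    (hv : HasDerivAt v v' 0) : HasDerivAt u 0 0 ↔ v' = 0 := by
  rw [huv.hasDerivAt_iff]
  exact ⟨fun h => hv.unique h, fun h => h ▸ hv⟩

theorem forall_pt_iff {u : ℝ → ℝ → Prop} : (∀ p : Pt, u (p 1) (p 2)) ↔ ∀ r x, u r x :=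
  ⟨fun h r x => h ![0, r, x], fun h _ => h _ _⟩

theorem extDeriv2_firstOrder {d : FirstOrderData} (hd : d.Smooth) :
    (∀ a b c p, extDeriv2 d.maxwell a b c p = 0) ↔ ∀ x, 2 * d.W x = deriv d.Ψ x := by
  have e : d.maxwell = jetForm (Jet.monomial 1 d.Ψ) (Jet.monomial 2 d.W) (Jet.monomial 0 d.Z) := by
    funext p
    simp [FirstOrderData.maxwell, jetForm, Jet.monomial]
  rw [e, extDeriv2_jetForm (Jet.holonomic_monomial 1 hd.Ψ) (Jet.holonomic_monomial 2 hd.W)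
    (Jet.holonomic_monomial 0 hd.Z)]
  refine ⟨fun h x => by simpa [Jet.monomial] using h 1 x, fun h r x => ?_⟩
  have := h x
  simp [Jet.monomial, ← this]
  ring

theorem linVacuumEinstein_iff (Λ f h ψ : ℝ) {d : FirstOrderData} (hd : d.MetricSmooth) :
    LinVacuumEinstein Λ (constHorizon f h ψ).metric d.metric ↔
      ∀ b c r x, linVacuum Λ f h d r x b c = 0 := by
  refine forall₂_congr fun b c => Iff.trans (forall_congr' fun p => ?_) forall_pt_iff
  refine hasDerivAt_iff_of_hasDerivAt ?_ (hasDerivAt_jetRicci Λ f h ψ d b c p)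
  exact (ricci_eventuallyEq (smooth_constHorizon f h ψ) hd b c p).sub
    (Filter.EventuallyEq.refl _ _)

theorem linEinsteinMaxwell_iff (Λ f h ψ : ℝ) {d : FirstOrderData} (hd : d.Smooth) :
    LinEinsteinMaxwell Λ (constHorizon f h ψ).metric (constHorizon f h ψ).maxwell
        d.metric d.maxwell ↔
      (∀ b c r x, linVacuum Λ f h d r x b c - linSource f h ψ d r x b c = 0) ∧
        (∀ c r x, linMaxwell f h ψ d r x c = 0) ∧ ∀ x, 2 * d.W x = deriv d.Ψ x := by
  refine and_congr ?_ (and_congr ?_ (extDeriv2_firstOrder hd))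
  · refine forall₂_congr fun b c => Iff.trans (forall_congr' fun p => ?_) forall_pt_iff
    exact hasDerivAt_iff_of_hasDerivAt
      (einsteinEq_eventuallyEq Λ (smooth_constHorizon f h ψ) hd b c p)
      ((hasDerivAt_jetRicci Λ f h ψ d b c p).fun_sub (hasDerivAt_jetSource f h ψ d b c p))
  · refine forall_congr' fun c => Iff.trans (forall_congr' fun p => ?_) forall_pt_iff
    exact hasDerivAt_iff_of_hasDerivAt (maxwellEq_eventuallyEq (smooth_constHorizon f h ψ) hd c p)
      (hasDerivAt_jetMaxwell f h ψ d c p)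

/-! ### The equations of a near-horizon geometry. -/

theorem HorizonData.metric_eq (H : HorizonData) :
    H.metric = jetMetric (Jet.monomial 2 H.F) (Jet.monomial 1 H.h) (Jet.monomial 0 fun _ => 1) := by
  funext p
  simp [HorizonData.metric, jetMetric, Jet.monomial]

theorem HorizonData.maxwell_eq (H : HorizonData) :
    H.maxwell = jetForm (Jet.monomial 0 H.Ψ) (Jet.monomial 1 H.W) (Jet.monomial 0 fun _ => 0) := by
  funext p
  simp [HorizonData.maxwell, jetForm, Jet.monomial]

theorem einsteinMaxwell_iff (Λ : ℝ) {H : HorizonData} (hH : H.Smooth) :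
    EinsteinMaxwell Λ H.metric H.maxwell ↔
      (∀ b c p, jetRicci (Jet.monomial 2 H.F) (Jet.monomial 1 H.h) (Jet.monomial 0 fun _ => 1) p b c
        - (jetSource (Jet.monomial 2 H.F) (Jet.monomial 1 H.h) (Jet.monomial 0 fun _ => 1)
          (Jet.monomial 0 H.Ψ) (Jet.monomial 1 H.W) (Jet.monomial 0 fun _ => 0) p b c
          + Λ * H.metric p b c) = 0) ∧
      (∀ c p, jetMaxwell (Jet.monomial 2 H.F) (Jet.monomial 1 H.h) (Jet.monomial 0 fun _ => 1)
        (Jet.monomial 0 H.Ψ) (Jet.monomial 1 H.W) (Jet.monomial 0 fun _ => 0) p c = 0) ∧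
      ∀ x, H.W x = deriv H.Ψ x := by
  have hA := Jet.holonomic_monomial 2 hH.F
  have hB := Jet.holonomic_monomial 1 hH.h
  have hC := Jet.holonomic_monomial 0 (contDiff_const (c := (1 : ℝ)) (n := ∞) (𝕜 := ℝ) (E := ℝ))
  have hP := Jet.holonomic_monomial 0 hH.Ψ
  have hW := Jet.holonomic_monomial 1 hH.W
  have hZ := Jet.holonomic_monomial 0 (contDiff_const (c := (0 : ℝ)) (n := ∞) (𝕜 := ℝ) (E := ℝ))
  have hne : ∀ p : Pt, (Jet.monomial 0 fun _ => 1).val (p 1) (p 2) ≠ 0 := by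
    intro p
    simp [Jet.monomial]
  refine and_congr ?_ (and_congr ?_ ?_)
  · refine forall₃_congr fun b c p => ?_
    rw [H.metric_eq, H.maxwell_eq, einsteinEq_jetMetric hA hB hC _ _ _ _ _ _ (hne p)]
  · refine forall₂_congr fun c p => ?_
    rw [H.metric_eq, H.maxwell_eq, maxwellEq_jetMetric hA hB hC hP hW hZ _ (hne p)]
  · rw [H.maxwell_eq, extDeriv2_jetForm hP hW hZ]
    exact ⟨fun h x => by simpa [Jet.monomial] using h 1 x, fun h r x => by simp [Jet.monomial, h x]⟩

/-- The horizon equations of a near-horizon geometry. -/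
theorem horizon_equations {Λ : ℝ} {H : HorizonData} (hH : H.Smooth)
    (h : EinsteinMaxwell Λ H.metric H.maxwell) (x : ℝ) :
    deriv H.h x = (1 / 2) * H.h x ^ 2 + 2 * H.Ψ x ^ 2 + Λ ∧
      H.F x = (1 / 2) * H.h x ^ 2 - (1 / 2) * deriv H.h x + Λ ∧
      deriv H.Ψ x = H.h x * H.Ψ x ∧ H.W x = deriv H.Ψ x := by
  obtain ⟨hE, hM, hW⟩ := (einsteinMaxwell_iff Λ hH).1 h
  -- The `vr` component gives `F`, the `xx` component gives `h'`, and the `x` component of the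
  -- Maxwell equation gives `W = hΨ`; all are read off at `r = 1`.
  have h01 := hE 0 1 ![0, 1, x]
  have h22 := hE 2 2 ![0, 1, x]
  have h2 := hM 2 ![0, 1, x]
  simp only [jetRicci, jetSource, jetMaxwell, H.metric_eq, jetMetric_apply, vec3_zero, vec3_one,
    vec3_two] at h01 h22 h2
  simp [Jet.monomial] at h01 h22 h2
  have hx := hW x
  refine ⟨?_, ?_, ?_, hx⟩ <;> linarith

/-- Sufficiency of the horizon equations for constant data. -/
theorem einsteinMaxwell_constHorizon {Λ f h ψ : ℝ} (hf : f = (1 / 2) * h ^ 2 + Λ)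
    (hh : (1 / 2) * h ^ 2 + 2 * ψ ^ 2 + Λ = 0) (hψ : h * ψ = 0) :
    EinsteinMaxwell Λ (constHorizon f h ψ).metric (constHorizon f h ψ).maxwell := by
  have hΛ : Λ = -((1 / 2) * h ^ 2 + 2 * ψ ^ 2) := by linarith
  rw [einsteinMaxwell_iff Λ (smooth_constHorizon f h ψ)]
  subst hf hΛ
  refine ⟨fun b c p => ?_, fun c p => ?_, fun x => by simp [constHorizon]⟩
  · rw [HorizonData.metric_eq, jetMetric_apply]
    -- With `f` and `Λ` eliminated, `hψ = 0` is the only relation left; in each branch the equations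
    -- are polynomial identities.
    rcases mul_eq_zero.1 hψ with rfl | rfl <;> fin_cases b <;> fin_cases c <;>
      simp only [jetRicci, jetSource, Fin.zero_eta, Fin.mk_one, Fin.reduceFinMk, vec3_zero,
        vec3_one, vec3_two] <;> simp [Jet.monomial, constHorizon] <;> ring
  · rcases mul_eq_zero.1 hψ with rfl | rfl <;> fin_cases c <;>
      simp only [jetMaxwell, Fin.zero_eta, Fin.mk_one, Fin.reduceFinMk, vec3_zero,
        vec3_one, vec3_two] <;> simp [Jet.monomial, constHorizon]

/-! ### Periodic solutions of the ordinary differential equations. -/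

theorem monotone_periodic_const {u : ℝ → ℝ} {T : ℝ} (hT : 0 < T) (hu : Function.Periodic u T)
    (hm : Monotone u) (x y : ℝ) : u x = u y := by
  have key : ∀ x y, u y ≤ u x := by
    intro x y
    obtain ⟨n, hn⟩ := Archimedean.arch (y - x) hT
    calc u y ≤ u (x + n • T) := hm (by linarith)
      _ = u x := hu.nsmul n x
  exact le_antisymm (key y x) (key x y)

/-- A monotone periodic function is constant. This is the rigidity mechanism behind the horizon
classification and the vanishing of Maxwell perturbations. -/
theorem deriv_eq_zero_of_periodic_of_nonneg {u u' : ℝ → ℝ} {T : ℝ} (hT : 0 < T)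
    (hu : Function.Periodic u T) (hd : ∀ x, HasDerivAt u (u' x) x) (h0 : ∀ x, 0 ≤ u' x) (x : ℝ) :
    u' x = 0 := by
  have hm : Monotone u := monotone_of_hasDerivAt_nonneg hd h0
  have hc : u = fun _ => u 0 := funext fun y => monotone_periodic_const hT hu hm y 0
  have h1 := hd x
  rw [hc] at h1
  exact h1.unique (hasDerivAt_const _ _)

theorem deriv_eq_zero_of_periodic_of_nonpos {u u' : ℝ → ℝ} {T : ℝ} (hT : 0 < T)
    (hu : Function.Periodic u T) (hd : ∀ x, HasDerivAt u (u' x) x) (h0 : ∀ x, u' x ≤ 0) (x : ℝ) :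
    u' x = 0 := by
  have := deriv_eq_zero_of_periodic_of_nonneg (u := fun x => -u x) (u' := fun x => -u' x) hT
    (fun y => by simp [hu y]) (fun y => (hd y).fun_neg) (fun y => by simpa using h0 y) x
  simpa using this

/-- A periodic solution of `u' = c u` with constant `c ≠ 0` vanishes. -/
theorem eq_zero_of_periodic_of_deriv_eq_const_mul {u : ℝ → ℝ} {T c : ℝ} (hT : 0 < T) (hc : c ≠ 0)
    (hu : Function.Periodic u T) (hd : ∀ x, HasDerivAt u (c * u x) x) (x : ℝ) : u x = 0 := by
  -- Dividing `u²` by `c` makes the derivative `2u²`, nonnegative for either sign of `c`.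
  have hsq : ∀ y, HasDerivAt (fun y => u y ^ 2 / c) (2 * u y ^ 2) y := fun y =>
    (((hd y).fun_pow 2).div_const c).congr_deriv (by field_simp; push_cast; ring)
  have h := deriv_eq_zero_of_periodic_of_nonneg hT (fun y => by simp [hu y]) hsq
    (fun y => by positivity) x
  simpa using h

theorem hasDerivAt_of_contDiff {u : ℝ → ℝ} (hu : ContDiff ℝ ∞ u) (x : ℝ) :
    HasDerivAt u (deriv u x) x :=
  (hu.differentiable (by simp) x).hasDerivAt

theorem hasDerivAt_integral {u : ℝ → ℝ} (hu : Continuous u) (x : ℝ) :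
    HasDerivAt (fun y => ∫ t in (0 : ℝ)..y, u t) (u x) x :=
  intervalIntegral.integral_hasDerivAt_right (hu.intervalIntegrable _ _)
    (hu.stronglyMeasurableAtFilter _ _) hu.continuousAt

theorem eq_const_of_hasDerivAt_zero {u : ℝ → ℝ} (hu : ∀ x, HasDerivAt u 0 x) (x y : ℝ) :
    u x = u y :=
  is_const_of_deriv_eq_zero (fun z => (hu z).differentiableAt) (fun z => (hu z).deriv) x y

/-- Solutions of the linear equation `u' = h u`. -/
theorem eq_mul_exp_integral {u h : ℝ → ℝ} (hh : Continuous h)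
    (hd : ∀ x, HasDerivAt u (h x * u x) x) (x : ℝ) :
    u x = u 0 * Real.exp (∫ t in (0 : ℝ)..x, h t) := by
  have hc : ∀ y, HasDerivAt (fun y => u y * Real.exp (-∫ t in (0 : ℝ)..y, h t)) 0 y := fun y =>
    ((hd y).fun_mul (hasDerivAt_integral hh y).fun_neg.exp).congr_deriv (by ring)
  have h0 := eq_const_of_hasDerivAt_zero hc x 0
  simp only [intervalIntegral.integral_same, neg_zero, Real.exp_zero, mul_one] at h0
  rw [← h0, mul_assoc, ← Real.exp_add]
  simp

/-- The periodic solutions of the horizon equations. -/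
theorem periodic_horizon_solutions {T Λ : ℝ} (hT : 0 < T) {h Ψ : ℝ → ℝ}
    (hhc : Continuous h) (hhp : Function.Periodic h T) (hΨp : Function.Periodic Ψ T)
    (hh : ∀ x, HasDerivAt h ((1 / 2) * h x ^ 2 + 2 * Ψ x ^ 2 + Λ) x)
    (hΨ : ∀ x, HasDerivAt Ψ (h x * Ψ x) x) :
    (∀ x, h x = 0 ∧ Ψ x = Ψ 0 ∧ 2 * Ψ 0 ^ 2 + Λ = 0) ∨
      ∀ x, Ψ x = 0 ∧ h x = h 0 ∧ h 0 ^ 2 + 2 * Λ = 0 := by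
  have hexp := eq_mul_exp_integral hhc hΨ
  set I : ℝ → ℝ := fun x => ∫ t in (0 : ℝ)..x, h t with hI
  have hId : ∀ x, HasDerivAt I (h x) x := hasDerivAt_integral hhc
  by_cases h0 : Ψ 0 = 0
  · right
    have hΨ0 : ∀ x, Ψ x = 0 := fun x => by rw [hexp x, h0, zero_mul]
    have hh' : ∀ x, HasDerivAt h ((1 / 2) * (h x ^ 2 + 2 * Λ)) x := fun x =>
      (hh x).congr_deriv (by rw [hΨ0 x]; ring)
    -- Since `h² + 2Λ` solves `u' = hu`, it keeps the sign it has at `0`, hence so does `h'`.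
    have hu : ∀ x, HasDerivAt (fun y => h y ^ 2 + 2 * Λ) (h x * (h x ^ 2 + 2 * Λ)) x := fun x =>
      (((hh' x).fun_pow 2).add_const _).congr_deriv (by ring)
    have hue := eq_mul_exp_integral hhc hu
    have hz : ∀ x, (1 / 2) * (h x ^ 2 + 2 * Λ) = 0 := by
      rcases le_total 0 (h 0 ^ 2 + 2 * Λ) with hs | hs
      · refine deriv_eq_zero_of_periodic_of_nonneg hT hhp hh' fun x => ?_
        rw [hue x]
        exact mul_nonneg (by norm_num) (mul_nonneg hs (Real.exp_pos _).le)
      · refine deriv_eq_zero_of_periodic_of_nonpos hT hhp hh' fun x => ?_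
        rw [hue x]
        exact mul_nonpos_of_nonneg_of_nonpos (by norm_num)
          (mul_nonpos_of_nonpos_of_nonneg hs (Real.exp_pos _).le)
    have hconst := eq_const_of_hasDerivAt_zero fun x => (hh' x).congr_deriv (hz x)
    exact fun x => ⟨hΨ0 x, hconst x 0, by linarith [hz 0]⟩
  · left
    -- As `Ψ = Ψ(0) exp I` is periodic and nonzero, the integral of `h` over a period vanishes.
    have hIp : Function.Periodic I T := fun x => by
      have h1 := hΨp x
      rw [hexp (x + T), hexp x] at h1
      exact Real.exp_injective (mul_left_cancel₀ h0 h1)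
    -- The factor `exp(-I / 2)` cancels the contribution `½h²(2Ψ² + Λ)` of `h'`, the only term
    -- without a definite sign, and leaves a sum of squares.
    have hN : ∀ x, HasDerivAt (fun y => h y * (2 * Ψ y ^ 2 + Λ) * Real.exp (-I y / 2))
        (((2 * Ψ x ^ 2 + Λ) ^ 2 + 4 * (h x * Ψ x) ^ 2) * Real.exp (-I x / 2)) x := fun x =>
      (((hh x).fun_mul ((((hΨ x).fun_pow 2).const_mul 2).add_const Λ)).fun_mul
        ((hId x).fun_neg.div_const 2).exp).congr_deriv (by push_cast; ring)
    have hz := deriv_eq_zero_of_periodic_of_nonneg hT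
      (fun y => by simp only [hhp y, hΨp y, hIp y]) hN fun x => by positivity
    have hv : ∀ x, 2 * Ψ x ^ 2 + Λ = 0 ∧ h x * Ψ x = 0 := fun x => by
      have h1 := (mul_eq_zero.1 (hz x)).resolve_right (Real.exp_pos _).ne'
      constructor <;> nlinarith [sq_nonneg (2 * Ψ x ^ 2 + Λ), sq_nonneg (h x * Ψ x)]
    have hconst := eq_const_of_hasDerivAt_zero fun x => (hΨ x).congr_deriv (hv x).2
    refine fun x => ⟨?_, hconst x 0, (hv 0).1⟩
    refine (mul_eq_zero.1 (hv x).2).resolve_right ?_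
    rw [hconst x 0]
    exact h0

/-! ### Classification of the near-horizon geometries. -/

theorem adS2S1_eq (ℓ σ : ℝ) : adS2S1 ℓ σ = constHorizon (-2 / ℓ ^ 2) 0 (σ / ℓ) := rfl

theorem localAdS3_eq (ℓ σ : ℝ) : localAdS3 ℓ σ = constHorizon 0 (2 * σ / ℓ) 0 := rfl

theorem smoothPeriodic_const (R c : ℝ) : SmoothPeriodic R fun _ => c :=
  ⟨contDiff_const, fun _ => rfl⟩

theorem exists_sign_of_sq_eq {a c ℓ : ℝ} (h : a ^ 2 = (c / ℓ) ^ 2) :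
    ∃ σ : ℝ, (σ = 1 ∨ σ = -1) ∧ a = c * σ / ℓ := by
  rcases sq_eq_sq_iff_eq_or_eq_neg.1 h with h | h
  · exact ⟨1, Or.inl rfl, by rw [h, mul_one]⟩
  · exact ⟨-1, Or.inr rfl, by rw [h]; ring⟩

/-- The classification of the near-horizon geometries. -/
theorem isNearHorizonGeometry_iff {ℓ R Λ : ℝ} (hℓ : 0 < ℓ) (hR : 0 < R) (hΛ : Λ = -2 / ℓ ^ 2)
    (H : HorizonData) :
    IsNearHorizonGeometry Λ R H ↔
      ∃ σ : ℝ, (σ = 1 ∨ σ = -1) ∧ (H = adS2S1 ℓ σ ∨ H = localAdS3 ℓ σ) := by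
  have hT : 0 < 2 * Real.pi * R := by positivity
  constructor
  · rintro ⟨hF, hh, hΨ, hW, hE⟩
    have heq := horizon_equations ⟨hF.1, hh.1, hΨ.1, hW.1⟩ hE
    rcases periodic_horizon_solutions hT hh.1.continuous hh.2 hΨ.2
      (fun x => (hasDerivAt_of_contDiff hh.1 x).congr_deriv (heq x).1)
      (fun x => (hasDerivAt_of_contDiff hΨ.1 x).congr_deriv (heq x).2.2.1) with hs | hs
    · have hsq : H.Ψ 0 ^ 2 = (1 / ℓ) ^ 2 := by
        have := (hs 0).2.2
        rw [hΛ] at this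
        field_simp at this ⊢
        linarith
      obtain ⟨σ, hσ, hΨσ⟩ := exists_sign_of_sq_eq hsq
      rw [one_mul] at hΨσ
      refine ⟨σ, hσ, Or.inl ?_⟩
      have hh0 : H.h = fun _ => 0 := funext fun x => (hs x).1
      ext x
      · rw [(heq x).2.1, hh0, hΛ]
        simp [adS2S1]
      · exact (hs x).1
      · exact (hs x).2.1.trans hΨσ
      · rw [(heq x).2.2.2, (heq x).2.2.1, (hs x).1, zero_mul]
        rfl
    · have hsq : H.h 0 ^ 2 = (2 / ℓ) ^ 2 := by
        have := (hs 0).2.2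
        rw [hΛ] at this
        field_simp at this ⊢
        linarith
      obtain ⟨σ, hσ, hhσ⟩ := exists_sign_of_sq_eq hsq
      refine ⟨σ, hσ, Or.inr ?_⟩
      have hh0 : H.h = fun _ => H.h 0 := funext fun x => (hs x).2.1
      ext x
      · have h1 := (heq x).2.1
        rw [hh0] at h1
        simp only [deriv_const] at h1
        rw [h1]
        show _ = (0 : ℝ)
        linarith [(hs 0).2.2]
      · exact (hs x).2.1.trans hhσ
      · exact (hs x).1
      · rw [(heq x).2.2.2, (heq x).2.2.1, (hs x).1, mul_zero]
        rfl
  · rintro ⟨σ, hσ, rfl | rfl⟩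
    · refine ⟨smoothPeriodic_const _ _, smoothPeriodic_const _ _, smoothPeriodic_const _ _,
        smoothPeriodic_const _ _, ?_⟩
      rw [adS2S1_eq]
      apply einsteinMaxwell_constHorizon
      · rw [hΛ]; ring
      · rw [hΛ]; rcases hσ with rfl | rfl <;> ring
      · ring
    · refine ⟨smoothPeriodic_const _ _, smoothPeriodic_const _ _, smoothPeriodic_const _ _,
        smoothPeriodic_const _ _, ?_⟩
      rw [localAdS3_eq]
      apply einsteinMaxwell_constHorizon
      · rw [hΛ]; rcases hσ with rfl | rfl <;> ring
      · rw [hΛ]; rcases hσ with rfl | rfl <;> ring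
      · ring

/-! ### Smooth functions on the circle, means and periodic primitives. -/

theorem SmoothPeriodic.deriv {R : ℝ} {u : ℝ → ℝ} (hu : SmoothPeriodic R u) :
    SmoothPeriodic R (deriv u) := by
  refine ⟨(contDiff_infty_iff_deriv.1 hu.1).2, fun x => ?_⟩
  rw [← deriv_comp_add_const u (2 * Real.pi * R) x]
  congr 1
  exact funext hu.2

theorem SmoothPeriodic.add {R : ℝ} {u v : ℝ → ℝ} (hu : SmoothPeriodic R u)
    (hv : SmoothPeriodic R v) : SmoothPeriodic R fun x => u x + v x :=
  ⟨hu.1.add hv.1, fun x => by simp only [hu.2 x, hv.2 x]⟩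

theorem SmoothPeriodic.sub {R : ℝ} {u v : ℝ → ℝ} (hu : SmoothPeriodic R u)
    (hv : SmoothPeriodic R v) : SmoothPeriodic R fun x => u x - v x :=
  ⟨hu.1.sub hv.1, fun x => by simp only [hu.2 x, hv.2 x]⟩

theorem SmoothPeriodic.const_mul {R : ℝ} {u : ℝ → ℝ} (c : ℝ) (hu : SmoothPeriodic R u) :
    SmoothPeriodic R fun x => c * u x :=
  ⟨contDiff_const.mul hu.1, fun x => by simp only [hu.2 x]⟩

theorem SmoothPeriodic.hasDerivAt {R : ℝ} {u : ℝ → ℝ} (hu : SmoothPeriodic R u) (x : ℝ) :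
    HasDerivAt u (_root_.deriv u x) x :=
  hasDerivAt_of_contDiff hu.1 x

theorem SmoothPeriodic.congr {R : ℝ} {u v : ℝ → ℝ} (hu : SmoothPeriodic R u)
    (h : ∀ x, v x = u x) : SmoothPeriodic R v :=
  funext h ▸ hu

section Mean

variable {R : ℝ} {u v : ℝ → ℝ}

theorem mean_const (hR : 0 < R) (c : ℝ) : mean R (fun _ => c) = c := by
  have : Real.pi ≠ 0 := Real.pi_ne_zero
  simp only [mean, intervalIntegral.integral_const, smul_eq_mul, sub_zero]
  field_simp

theorem mean_add (hu : SmoothPeriodic R u) (hv : SmoothPeriodic R v) :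
    mean R (fun x => u x + v x) = mean R u + mean R v := by
  simp only [mean]
  rw [intervalIntegral.integral_add (hu.1.continuous.intervalIntegrable _ _)
    (hv.1.continuous.intervalIntegrable _ _), mul_add]

theorem mean_sub (hu : SmoothPeriodic R u) (hv : SmoothPeriodic R v) :
    mean R (fun x => u x - v x) = mean R u - mean R v := by
  simp only [mean]
  rw [intervalIntegral.integral_sub (hu.1.continuous.intervalIntegrable _ _)
    (hv.1.continuous.intervalIntegrable _ _), mul_sub]

theorem mean_const_mul (c : ℝ) : mean R (fun x => c * u x) = c * mean R u := by
  simp only [mean, intervalIntegral.integral_const_mul]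
  ring

theorem mean_deriv (hu : SmoothPeriodic R u) : mean R (deriv u) = 0 := by
  rw [mean, intervalIntegral.integral_eq_sub_of_hasDerivAt (fun x _ => hu.hasDerivAt x)
    (hu.deriv.1.continuous.intervalIntegrable _ _)]
  have := hu.2 0
  rw [zero_add] at this
  simp [this]

theorem mean_sub_mean (hR : 0 < R) (hu : SmoothPeriodic R u) :
    mean R (fun x => u x - mean R u) = 0 := by
  rw [mean_sub hu (smoothPeriodic_const R _), mean_const hR, sub_self]

theorem integral_period_eq_zero (hR : 0 < R) (h0 : mean R u = 0) :
    ∫ x in (0 : ℝ)..(2 * Real.pi * R), u x = 0 := by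
  have : 1 / (2 * Real.pi * R) ≠ 0 := by positivity
  exact (mul_eq_zero.1 h0).resolve_left this

theorem smoothPeriodic_integral (hR : 0 < R) (hu : SmoothPeriodic R u) (h0 : mean R u = 0) :
    SmoothPeriodic R fun x => ∫ t in (0 : ℝ)..x, u t := by
  have hd := hasDerivAt_integral hu.1.continuous
  refine ⟨contDiff_infty_iff_deriv.2 ⟨fun x => (hd x).differentiableAt, ?_⟩, fun x => ?_⟩
  · rw [show deriv (fun x => ∫ t in (0 : ℝ)..x, u t) = u from funext fun x => (hd x).deriv]
    exact hu.1
  · have hi := fun a b => hu.1.continuous.intervalIntegrable (μ := MeasureTheory.volume) a b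
    have h1 := hu.2.intervalIntegral_add_eq x 0
    rw [zero_add, integral_period_eq_zero hR h0] at h1
    show (∫ t in (0 : ℝ)..(x + 2 * Real.pi * R), u t) = _
    rw [← intervalIntegral.integral_add_adjacent_intervals (hi 0 x) (hi x _), h1, add_zero]

/-- A function of mean zero on the circle is the second derivative of a function on the circle. -/
theorem exists_deriv_deriv_eq (hR : 0 < R) (hu : SmoothPeriodic R u) (h0 : mean R u = 0) :
    ∃ f : ℝ → ℝ, SmoothPeriodic R f ∧ deriv (deriv f) = u := by
  set U : ℝ → ℝ := fun x => ∫ t in (0 : ℝ)..x, u t with hU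
  have hUp : SmoothPeriodic R U := smoothPeriodic_integral hR hu h0
  have hUd : deriv U = u := funext fun x => (hasDerivAt_integral hu.1.continuous x).deriv
  -- Removing the mean of the first primitive makes the second one periodic and does not affect the
  -- second derivative.
  have hV := hUp.sub (smoothPeriodic_const R (mean R U))
  refine ⟨_, smoothPeriodic_integral hR hV (mean_sub_mean hR hUp), ?_⟩
  rw [show deriv (fun x => ∫ t in (0 : ℝ)..x, (U t - mean R U)) = fun x => U x - mean R U from
    funext fun x => (hasDerivAt_integral hV.1.continuous x).deriv]
  funext x
  rw [deriv_sub_const, hUd]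

end Mean

/-! ### Deformations of AdS₂ × S¹. -/

theorem IsTransverseDeformation.smooth {Λ R : ℝ} {H : HorizonData} {d : FirstOrderData}
    (h : IsTransverseDeformation Λ R H d) : d.Smooth :=
  ⟨⟨h.1.1, h.2.1.1, h.2.2.1.1⟩, h.2.2.2.1.1, h.2.2.2.2.1.1, h.2.2.2.2.2.1.1⟩

/-- The linearised equations at `AdS₂ × S¹`. -/
theorem linEinsteinMaxwell_adS2S1_iff (ψ : ℝ) {d : FirstOrderData} (hd : d.Smooth) :
    LinEinsteinMaxwell (-2 * ψ ^ 2) (constHorizon (-2 * ψ ^ 2) 0 ψ).metric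
        (constHorizon (-2 * ψ ^ 2) 0 ψ).maxwell d.metric d.maxwell ↔
      ∀ x, d.h x = 2 * ψ * d.Z x ∧ HasDerivAt d.Z (d.Ψ x + (1 / 2) * ψ * d.γ x) x ∧
        d.F x = -((2 / 3) * ψ * d.Ψ x) ∧ d.W x = 0 ∧ HasDerivAt d.Ψ 0 x := by
  rw [linEinsteinMaxwell_iff _ _ _ _ hd]
  constructor
  · rintro ⟨hE, hM, hW⟩ x
    -- These components at `r = 1`, together with closure `2W = Ψ'`, already give the reduced
    -- system; the converse direction shows that the others follow.
    have h01 := hE 0 1 1 x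
    have h12 := hE 1 2 1 x
    have h22 := hE 2 2 1 x
    have h1 := hM 1 1 x
    have h2 := hM 2 1 x
    have hx := hW x
    simp only [linVacuum, linSource, linMaxwell, vec3_zero, vec3_one, vec3_two] at h01 h12 h22 h1 h2
    have hh : d.h x = 2 * ψ * d.Z x := by linarith
    -- For `F⁽⁰⁾ = -2ψ²` the terms `4ψ²Z` and `-2ψh = -4ψ²Z` cancel, leaving `2W = 0`.
    have hW0 : d.W x = 0 := by
      rw [hh] at h2
      linarith
    refine ⟨hh, (hasDerivAt_of_contDiff hd.Z x).congr_deriv (by linarith), by linarith, hW0,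
      (hasDerivAt_of_contDiff hd.Ψ x).congr_deriv (by linarith)⟩
  · intro h
    have hh : d.h = fun x => 2 * ψ * d.Z x := funext fun x => (h x).1
    have hF : d.F = fun x => -((2 / 3) * ψ * d.Ψ x) := funext fun x => (h x).2.2.1
    have hW : d.W = fun _ => 0 := funext fun x => (h x).2.2.2.1
    have hΨ' : deriv d.Ψ = fun _ => 0 := funext fun x => (h x).2.2.2.2.deriv
    have hZ' : ∀ x, deriv d.Z x = d.Ψ x + (1 / 2) * ψ * d.γ x := fun x => (h x).2.1.deriv
    have hh' : ∀ x, deriv d.h x = 2 * ψ * (d.Ψ x + (1 / 2) * ψ * d.γ x) := fun x => by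
      rw [hh]
      exact ((h x).2.1.const_mul _).deriv
    have hF' : deriv d.F = fun _ => 0 := funext fun x => by
      rw [hF]
      simpa using ((h x).2.2.2.2.const_mul ((2 / 3) * ψ)).fun_neg.deriv
    refine ⟨fun b c r x => ?_, fun c r x => ?_, fun x => ?_⟩
    · fin_cases b <;> fin_cases c <;>
        simp only [linVacuum, linSource, Fin.zero_eta, Fin.mk_one, Fin.reduceFinMk, vec3_zero,
          vec3_one, vec3_two, hF', hh', (h x).1, (h x).2.2.1, (h x).2.2.2.1, deriv_const] <;> ring
    · fin_cases c <;>
        simp only [linMaxwell, Fin.zero_eta, Fin.mk_one, Fin.reduceFinMk, vec3_zero, vec3_one,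
          vec3_two, hΨ', hh', hZ', (h x).1, hW, deriv_const] <;> ring
    · simp [hW, hΨ']

/-- The deformations of `AdS₂ × S¹`. -/
theorem isTransverseDeformation_adS2S1_iff {R : ℝ} (hR : 0 < R) (ψ : ℝ) (d : FirstOrderData) :
    IsTransverseDeformation (-2 * ψ ^ 2) R (constHorizon (-2 * ψ ^ 2) 0 ψ) d ↔
      SmoothPeriodic R d.γ ∧ ∃ a : ℝ, ∀ x : ℝ,
        d.Z x = a + (1 / 2) * ψ * ∫ y in (0 : ℝ)..x, (d.γ y - mean R d.γ) ∧
        d.h x = 2 * ψ * d.Z x ∧ d.F x = (1 / 3) * ψ ^ 2 * mean R d.γ ∧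
        d.Ψ x = -((1 / 2) * ψ * mean R d.γ) ∧ d.W x = 0 := by
  constructor
  · intro hD
    have hs := hD.smooth
    obtain ⟨-, -, hγ, -, -, hZ, hL⟩ := hD
    rw [linEinsteinMaxwell_adS2S1_iff ψ hs] at hL
    have hΨc : ∀ x, d.Ψ x = d.Ψ 0 := fun x =>
      eq_const_of_hasDerivAt_zero (fun y => (hL y).2.2.2.2) x 0
    have hZ' : deriv d.Z = fun x => d.Ψ 0 + (1 / 2) * ψ * d.γ x := funext fun x => by
      rw [(hL x).2.1.deriv, hΨc x]
    -- The mean of `Z' = Ψ + ½ψγ` vanishes because `Z` is periodic.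
    have hΨ0 : d.Ψ 0 = -((1 / 2) * ψ * mean R d.γ) := by
      have h0 := mean_deriv hZ
      rw [hZ', mean_add (smoothPeriodic_const R _) (hγ.const_mul _), mean_const hR,
        mean_const_mul] at h0
      linarith
    have hb := hγ.sub (smoothPeriodic_const R (mean R d.γ))
    have hc : ∀ x, HasDerivAt (fun x => d.Z x - (1 / 2) * ψ *
        ∫ y in (0 : ℝ)..x, (d.γ y - mean R d.γ)) 0 x := fun x =>
      ((hL x).2.1.fun_sub ((hasDerivAt_integral hb.1.continuous x).const_mul _)).congr_deriv (by
        rw [hΨc x, hΨ0]; ring)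
    refine ⟨hγ, d.Z 0, fun x => ⟨?_, (hL x).1, ?_, (hΨc x).trans hΨ0, (hL x).2.2.2.1⟩⟩
    · have := eq_const_of_hasDerivAt_zero hc x 0
      simp only [intervalIntegral.integral_same, mul_zero, sub_zero] at this
      linarith
    · rw [(hL x).2.2.1, hΨc x, hΨ0]
      ring
  · rintro ⟨hγ, a, h⟩
    have hb := hγ.sub (smoothPeriodic_const R (mean R d.γ))
    have hZ : SmoothPeriodic R d.Z := ((smoothPeriodic_const R a).add
      ((smoothPeriodic_integral hR hb (mean_sub_mean hR hγ)).const_mul _)).congr fun x => (h x).1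
    have hh : SmoothPeriodic R d.h := (hZ.const_mul (2 * ψ)).congr fun x => (h x).2.1
    have hF : SmoothPeriodic R d.F := (smoothPeriodic_const R _).congr fun x => (h x).2.2.1
    have hΨ : SmoothPeriodic R d.Ψ := (smoothPeriodic_const R _).congr fun x => (h x).2.2.2.1
    have hW : SmoothPeriodic R d.W := (smoothPeriodic_const R _).congr fun x => (h x).2.2.2.2
    refine ⟨hF, hh, hγ, hΨ, hW, hZ, ?_⟩
    rw [linEinsteinMaxwell_adS2S1_iff ψ ⟨⟨hF.1, hh.1, hγ.1⟩, hΨ.1, hW.1, hZ.1⟩]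
    refine fun x => ⟨(h x).2.1, ?_, ?_, (h x).2.2.2.2, ?_⟩
    · rw [show d.Z = _ from funext fun y => (h y).1]
      exact (((hasDerivAt_integral hb.1.continuous x).const_mul _).const_add a).congr_deriv (by
        rw [(h x).2.2.2.1]; ring)
    · rw [(h x).2.2.1, (h x).2.2.2.1]
      ring
    · rw [show d.Ψ = _ from funext fun y => (h y).2.2.2.1]
      exact hasDerivAt_const _ _

/-! ### Gauge transformations at AdS₂ × S¹. -/

theorem FirstOrderData.metric_inj {d d' : FirstOrderData} (h : ∀ p, d.metric p = d'.metric p) :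
    d.F = d'.F ∧ d.h = d'.h ∧ d.γ = d'.γ := by
  refine ⟨funext fun x => ?_, funext fun x => ?_, funext fun x => ?_⟩
  · simpa [FirstOrderData.metric] using congrFun (congrFun (h ![0, 1, x]) 0) 0
  · simpa [FirstOrderData.metric] using congrFun (congrFun (h ![0, 1, x]) 0) 2
  · simpa [FirstOrderData.metric] using congrFun (congrFun (h ![0, 1, x]) 2) 2

theorem FirstOrderData.maxwell_inj {d d' : FirstOrderData} (h : ∀ p, d.maxwell p = d'.maxwell p) :
    d.Ψ = d'.Ψ ∧ d.W = d'.W ∧ d.Z = d'.Z := by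
  refine ⟨funext fun x => ?_, funext fun x => ?_, funext fun x => ?_⟩
  · simpa [FirstOrderData.maxwell] using congrFun (congrFun (h ![0, 1, x]) 0) 1
  · simpa [FirstOrderData.maxwell] using congrFun (congrFun (h ![0, 1, x]) 0) 2
  · simpa [FirstOrderData.maxwell] using congrFun (congrFun (h ![0, 1, x]) 1) 2

/-- The action of the gauge transformation generated by `f` at `AdS₂ × S¹`. -/
def gaugeAct (ψ : ℝ) (f : ℝ → ℝ) (d : FirstOrderData) : FirstOrderData where
  F := d.F
  h := fun x => d.h x + ψ ^ 2 * deriv f x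
  γ := fun x => d.γ x + deriv (deriv f) x
  Ψ := d.Ψ
  W := d.W
  Z := fun x => d.Z x + (1 / 2) * ψ * deriv f x

/-- The derivatives of the gauge vector field of a horizon with `h⁽⁰⁾ = 0`. -/
def gaugeVectorDeriv (f : ℝ → ℝ) (p : Pt) (i s : Fin 3) : ℝ :=
  vec3 (vec3 0 0 ((1 / 2) * deriv f (p 2)) i) 0
    (vec3 0 (-((1 / 2) * deriv f (p 2))) (-((1 / 2) * p 1 * deriv (deriv f) (p 2))) i) s

theorem pd_gaugeVector (c ψ : ℝ) {f : ℝ → ℝ} (hf : ContDiff ℝ ∞ f) (i s : Fin 3) (p : Pt) :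
    pd i (fun q => gaugeVector (constHorizon c 0 ψ) f q s) p = gaugeVectorDeriv f p i s := by
  have h1 := ((Jet.holonomic_monomial 0 hf).hasPd_val i p).const_mul (1 / 2)
  have h2 := (((Jet.holonomic_monomial 1 (contDiff_infty_iff_deriv.1 hf).2).hasPd_val i p).const_mul
    (1 / 2)).neg
  fin_cases s
  · have e : (fun q => gaugeVector (constHorizon c 0 ψ) f q 0)
        = fun q : Pt => 1 / 2 * (Jet.monomial 0 f).val (q 1) (q 2) := by
      funext q
      simp [gaugeVector, Jet.monomial]
    refine (congrArg (fun u => pd i u p) e).trans (h1.pd.trans ?_)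
    fin_cases i <;> simp [gaugeVectorDeriv, vec3, Jet.grad, Jet.monomial]
  · have e : (fun q => gaugeVector (constHorizon c 0 ψ) f q 1) = fun _ => 0 := by
      funext q
      simp [gaugeVector, constHorizon]
    exact (congrArg (fun u => pd i u p) e).trans (hasPd_const i 0 p).pd
  · have e : (fun q => gaugeVector (constHorizon c 0 ψ) f q 2)
        = fun q : Pt => -(1 / 2 * (Jet.monomial 1 (deriv f)).val (q 1) (q 2)) := by
      funext q
      simp [gaugeVector, Jet.monomial]
      ring
    refine (congrArg (fun u => pd i u p) e).trans (h2.pd.trans ?_)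
    fin_cases i <;> simp [gaugeVectorDeriv, vec3, Jet.grad, Jet.monomial]
    ring

theorem pd_metric_constHorizon (c ψ : ℝ) (i a b : Fin 3) (p : Pt) :
    pd i (fun q => (constHorizon c 0 ψ).metric q a b) p
      = symEntry (vec3 0 (2 * p 1 * c) 0 i) 0 0 a b := by
  have hs := smooth_constHorizon c 0 ψ
  rw [HorizonData.metric_eq, ((Jet.holonomic_monomial 2 hs.F).hasPd_jetMetric
    (Jet.holonomic_monomial 1 hs.h) (Jet.holonomic_monomial 0 contDiff_const) i a b p).pd]
  fin_cases i <;> simp [jetMetricDeriv, Jet.grad, Jet.monomial, constHorizon, vec3]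

theorem pd_maxwell_constHorizon (c ψ : ℝ) (i a b : Fin 3) (p : Pt) :
    pd i (fun q => (constHorizon c 0 ψ).maxwell q a b) p = 0 := by
  have e : (fun q => (constHorizon c 0 ψ).maxwell q a b)
      = fun _ => (constHorizon c 0 ψ).maxwell 0 a b := by
    funext q
    simp [HorizonData.maxwell, constHorizon]
  rw [e]
  exact (hasPd_const i _ p).pd

theorem lieDeriv_metric (c ψ : ℝ) {f : ℝ → ℝ} (hf : ContDiff ℝ ∞ f) (p : Pt) :
    lieDeriv (gaugeVector (constHorizon c 0 ψ) f) (constHorizon c 0 ψ).metric p =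
      !![0, 0, p 1 ^ 2 * ((1 / 2) * c * deriv f (p 2));
         0, 0, 0;
         p 1 ^ 2 * ((1 / 2) * c * deriv f (p 2)), 0, -(p 1 * deriv (deriv f) (p 2))] := by
  ext a b
  simp only [lieDeriv, Matrix.of_apply, pd_gaugeVector c ψ hf, pd_metric_constHorizon,
    Fin.sum_univ_three]
  rw [HorizonData.metric_eq]
  simp only [jetMetric_apply]
  fin_cases a <;> fin_cases b <;>
    simp only [symEntry, gaugeVectorDeriv, Fin.zero_eta, Fin.mk_one, Fin.reduceFinMk, vec3_zero,
      vec3_one, vec3_two] <;> simp [gaugeVector, constHorizon, Jet.monomial] <;> ring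

theorem lieDeriv_maxwell (c ψ : ℝ) {f : ℝ → ℝ} (hf : ContDiff ℝ ∞ f) (p : Pt) :
    lieDeriv (gaugeVector (constHorizon c 0 ψ) f) (constHorizon c 0 ψ).maxwell p =
      !![0, 0, 0;
         0, 0, -((1 / 2) * ψ * deriv f (p 2));
         0, (1 / 2) * ψ * deriv f (p 2), 0] := by
  ext a b
  simp only [lieDeriv, Matrix.of_apply, pd_gaugeVector c ψ hf, pd_maxwell_constHorizon,
    Fin.sum_univ_three]
  rw [HorizonData.maxwell_eq]
  simp only [jetForm_apply]
  fin_cases a <;> fin_cases b <;>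
    simp only [skewEntry, gaugeVectorDeriv, Fin.zero_eta, Fin.mk_one, Fin.reduceFinMk, vec3_zero,
      vec3_one, vec3_two] <;> simp [constHorizon, Jet.monomial] <;> ring

/-- The Lie derivatives along the gauge vector have the same powers of `r` as first order data, and
tensors determine their data, so the gauge relation is the graph of an explicit action. -/
theorem isGaugeTransform_iff (ψ : ℝ) {f : ℝ → ℝ} (hf : ContDiff ℝ ∞ f) (d d' : FirstOrderData) :
    IsGaugeTransform (constHorizon (-2 * ψ ^ 2) 0 ψ) f d d' ↔ d' = gaugeAct ψ f d := by
  have hm : ∀ p, (gaugeAct ψ f d).metric p = d.metric p -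
      lieDeriv (gaugeVector (constHorizon (-2 * ψ ^ 2) 0 ψ) f)
        (constHorizon (-2 * ψ ^ 2) 0 ψ).metric p := fun p => by
    rw [lieDeriv_metric _ _ hf]
    ext a b
    fin_cases a <;> fin_cases b <;> simp [FirstOrderData.metric, gaugeAct] <;> ring
  have hM : ∀ p, (gaugeAct ψ f d).maxwell p = d.maxwell p -
      lieDeriv (gaugeVector (constHorizon (-2 * ψ ^ 2) 0 ψ) f)
        (constHorizon (-2 * ψ ^ 2) 0 ψ).maxwell p := fun p => by
    rw [lieDeriv_maxwell _ _ hf]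
    ext a b
    fin_cases a <;> fin_cases b <;> simp [FirstOrderData.maxwell, gaugeAct]
    ring
  constructor
  · rintro ⟨h1, h2⟩
    obtain ⟨hF, hh, hγ⟩ := FirstOrderData.metric_inj fun p => (h1 p).trans (hm p).symm
    obtain ⟨hΨ, hW, hZ⟩ := FirstOrderData.maxwell_inj fun p => (h2 p).trans (hM p).symm
    exact FirstOrderData.ext hF hh hγ hΨ hW hZ
  · rintro rfl
    exact ⟨hm, hM⟩

section AdS2S1

variable {R ψ : ℝ} {d : FirstOrderData}

/-- The reduced system is visibly invariant: `ψ²f' = 2ψ · ½ψf'` preserves `h = 2ψZ`, and `½ψf''` is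
added to both sides of the equation for `Z'`. -/
theorem isTransverseDeformation_gaugeAct
    (hd : IsTransverseDeformation (-2 * ψ ^ 2) R (constHorizon (-2 * ψ ^ 2) 0 ψ) d)
    {f : ℝ → ℝ} (hf : SmoothPeriodic R f) :
    IsTransverseDeformation (-2 * ψ ^ 2) R (constHorizon (-2 * ψ ^ 2) 0 ψ) (gaugeAct ψ f d) := by
  have hs := hd.smooth
  obtain ⟨hF, hh, hγ, hΨ, hW, hZ, hL⟩ := hd
  rw [linEinsteinMaxwell_adS2S1_iff ψ hs] at hL
  have hh' := hh.add (hf.deriv.const_mul (ψ ^ 2))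
  have hγ' := hγ.add hf.deriv.deriv
  have hZ' := hZ.add (hf.deriv.const_mul ((1 / 2) * ψ))
  have hs' : (gaugeAct ψ f d).Smooth := ⟨⟨hF.1, hh'.1, hγ'.1⟩, hΨ.1, hW.1, hZ'.1⟩
  refine ⟨hF, hh', hγ', hΨ, hW, hZ', ?_⟩
  rw [linEinsteinMaxwell_adS2S1_iff ψ hs']
  refine fun x => ⟨?_, ?_, (hL x).2.2⟩
  · simp only [gaugeAct, (hL x).1]
    ring
  · refine ((hL x).2.1.fun_add ((hf.deriv.hasDerivAt x).const_mul _)).congr_deriv ?_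
    simp only [gaugeAct]
    ring

theorem mean_gaugeAct (hd : SmoothPeriodic R d.γ) {f : ℝ → ℝ} (hf : SmoothPeriodic R f) :
    mean R (gaugeAct ψ f d).γ = mean R d.γ := by
  simp only [gaugeAct]
  rw [mean_add hd hf.deriv.deriv, mean_deriv hf.deriv, add_zero]

theorem gaugeEquivalent_iff (d' : FirstOrderData) :
    GaugeEquivalent R (constHorizon (-2 * ψ ^ 2) 0 ψ) d d' ↔
      ∃ f : ℝ → ℝ, SmoothPeriodic R f ∧ d' = gaugeAct ψ f d :=
  exists_congr fun _ => and_congr_right fun hf => isGaugeTransform_iff ψ hf.1 d d'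

theorem exists_gaugeAct_γ_eq (hR : 0 < R) (hd : SmoothPeriodic R d.γ) {u : ℝ → ℝ}
    (hu : SmoothPeriodic R u) (hm : mean R u = mean R d.γ) :
    ∃ f : ℝ → ℝ, SmoothPeriodic R f ∧ (gaugeAct ψ f d).γ = u := by
  obtain ⟨f, hf, hfu⟩ := exists_deriv_deriv_eq hR (hu.sub hd) (by rw [mean_sub hu hd, hm, sub_self])
  refine ⟨f, hf, funext fun x => ?_⟩
  simp only [gaugeAct, hfu]
  ring

theorem existsUnique_constData (hR : 0 < R)
    (hd : IsTransverseDeformation (-2 * ψ ^ 2) R (constHorizon (-2 * ψ ^ 2) 0 ψ) d) :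
    ∃! ab : ℝ × ℝ,
      GaugeEquivalent R (constHorizon (-2 * ψ ^ 2) 0 ψ) d (constData ψ ab.1 ab.2) := by
  have hγ : SmoothPeriodic R d.γ := hd.2.2.1
  have hZ : SmoothPeriodic R d.Z := hd.2.2.2.2.2.1
  -- Gauge transformations change `Z` and `γ` by derivatives of periodic functions, so both means
  -- are invariant; this yields uniqueness.
  have hmean : ∀ a b : ℝ,
      GaugeEquivalent R (constHorizon (-2 * ψ ^ 2) 0 ψ) d (constData ψ a b) →
        a = mean R d.Z ∧ b = mean R d.γ := by
    intro a b h
    obtain ⟨f, hf, he⟩ := (gaugeEquivalent_iff _).1 h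
    have hZe := congrArg FirstOrderData.Z he
    have hγe := congrArg (fun d => mean R (FirstOrderData.γ d)) he
    simp only [mean_gaugeAct hγ hf] at hγe
    simp only [constData, gaugeAct] at hZe hγe
    have hZe' := congrArg (mean R) hZe
    rw [mean_add hZ (hf.deriv.const_mul _), mean_const_mul, mean_deriv hf, mul_zero, add_zero,
      mean_const hR] at hZe'
    rw [mean_const hR] at hγe
    exact ⟨hZe', hγe⟩
  -- Once `γ` equals its mean, the integrand in the formula for `Z` vanishes and `Z` is constant as
  -- well.
  obtain ⟨f, hf, hfγ⟩ := exists_gaugeAct_γ_eq (ψ := ψ) hR hγ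
    (smoothPeriodic_const R (mean R d.γ)) (mean_const hR _)
  obtain ⟨-, a, ha⟩ := (isTransverseDeformation_adS2S1_iff hR ψ _).1
    (isTransverseDeformation_gaugeAct hd hf)
  simp only [hfγ, mean_const hR, sub_self, intervalIntegral.integral_zero, mul_zero,
    add_zero] at ha
  have hex : GaugeEquivalent R (constHorizon (-2 * ψ ^ 2) 0 ψ) d (constData ψ a (mean R d.γ)) := by
    refine (gaugeEquivalent_iff _).2 ⟨f, hf, ?_⟩
    ext x
    · exact (ha x).2.2.1.symm
    · rw [(ha x).2.1, (ha x).1]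
      rfl
    · rw [hfγ]
      rfl
    · exact (ha x).2.2.2.1.symm
    · exact (ha x).2.2.2.2.symm
    · exact (ha x).1.symm
  refine ⟨(a, mean R d.γ), hex, ?_⟩
  rintro ⟨a', b'⟩ h
  have h1 := hmean a' b' h
  have h2 := hmean a _ hex
  exact Prod.ext (h1.1.trans h2.1.symm) h1.2

end AdS2S1

/-! ### Deformations of locally AdS₃ horizons. -/

section LocalAdS3

variable {R h : ℝ}

/-- The linearised vacuum equations at locally `AdS₃` horizons. -/
theorem linVacuum_localAdS3_iff (h : ℝ) {d : FirstOrderData} (hd : d.MetricSmooth) :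
    (∀ b c r x, linVacuum (-((1 / 2) * h ^ 2)) 0 h d r x b c = 0) ↔
      ∀ x, d.h x = (1 / 4) * h * d.γ x ∧ d.F x = 0 := by
  have hdh : d.h = (fun x => (1 / 4) * h * d.γ x) →
      ∀ x, deriv d.h x = (1 / 4) * h * deriv d.γ x := fun e x => by
    rw [e]
    exact ((hasDerivAt_of_contDiff hd.γ x).const_mul _).deriv
  constructor
  · intro hE
    have h12 : ∀ x, d.h x = (1 / 4) * h * d.γ x := fun x => by
      have := hE 1 2 1 x
      simp only [linVacuum, vec3_one, vec3_two] at this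
      linarith
    refine fun x => ⟨h12 x, ?_⟩
    -- Inserting `d.h = ¼hγ` cancels every term of this component except `3F`.
    have h01 := hE 0 1 1 x
    simp only [linVacuum, vec3_zero, vec3_one, h12 x, hdh (funext h12) x] at h01
    linarith
  · intro hx b c r x
    have h12 : d.h = fun x => (1 / 4) * h * d.γ x := funext fun x => (hx x).1
    have hF : d.F = fun _ => 0 := funext fun x => (hx x).2
    fin_cases b <;> fin_cases c <;>
      simp only [linVacuum, Fin.zero_eta, Fin.mk_one, Fin.reduceFinMk, vec3_zero, vec3_one,
        vec3_two, hdh h12 x, (hx x).1, hF, deriv_const'] <;> ring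

/-- The source is quadratic in the Maxwell field, which vanishes in the background. -/
theorem linSource_zero (h : ℝ) (d : FirstOrderData) (r x : ℝ) (b c : Fin 3) :
    linSource 0 h 0 d r x b c = 0 := by
  fin_cases b <;> fin_cases c <;> simp [linSource, vec3]

/-- Maxwell perturbations of locally `AdS₃` horizons vanish. -/
theorem linMaxwell_localAdS3_iff (hR : 0 < R) (hh : h ≠ 0) {d : FirstOrderData}
    (hΨ : SmoothPeriodic R d.Ψ) (hZ : SmoothPeriodic R d.Z) :
    ((∀ c r x, linMaxwell 0 h 0 d r x c = 0) ∧ ∀ x, 2 * d.W x = deriv d.Ψ x) ↔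
      ∀ x, d.Z x = 0 ∧ d.Ψ x = 0 ∧ d.W x = 0 := by
  have hT : 0 < 2 * Real.pi * R := by positivity
  constructor
  · rintro ⟨hM, hW⟩
    have h1 : ∀ x, d.Ψ x = deriv d.Z x - h * d.Z x := fun x => by
      have := hM 1 1 x
      simp only [linMaxwell, vec3_one] at this
      linarith
    have h2 : ∀ x, d.W x = h * d.Ψ x := fun x => by
      have := hM 2 1 x
      simp only [linMaxwell, vec3_two] at this
      rw [h1 x] at this ⊢
      linarith
    -- Closure gives `Ψ' = 2W = 2hΨ`; once `Ψ = 0`, the relation `Ψ = Z' - hZ` becomes `Z' = hZ`.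
    have hΨ0 := eq_zero_of_periodic_of_deriv_eq_const_mul hT (mul_ne_zero two_ne_zero hh) hΨ.2
      fun x => (hΨ.hasDerivAt x).congr_deriv (by rw [← hW x, h2 x]; ring)
    have hZ0 := eq_zero_of_periodic_of_deriv_eq_const_mul hT hh hZ.2
      fun x => (hZ.hasDerivAt x).congr_deriv (by linarith [h1 x, hΨ0 x])
    exact fun x => ⟨hZ0 x, hΨ0 x, by rw [h2 x, hΨ0 x, mul_zero]⟩
  · intro hx
    have hZ0 : d.Z = fun _ => 0 := funext fun x => (hx x).1
    have hΨ0 : d.Ψ = fun _ => 0 := funext fun x => (hx x).2.1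
    have hW0 : d.W = fun _ => 0 := funext fun x => (hx x).2.2
    refine ⟨fun c r x => ?_, fun x => by simp [hΨ0, hW0]⟩
    fin_cases c <;> simp [linMaxwell, vec3, hZ0, hΨ0, hW0]

theorem isTransverseDeformation_localAdS3_iff_vacuum (hR : 0 < R) (hh : h ≠ 0)
    (d : FirstOrderData) :
    IsTransverseDeformation (-((1 / 2) * h ^ 2)) R (constHorizon 0 h 0) d ↔
      IsVacuumDeformation (-((1 / 2) * h ^ 2)) R (constHorizon 0 h 0) d ∧
        ∀ x, d.Z x = 0 ∧ d.Ψ x = 0 ∧ d.W x = 0 := by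
  constructor
  · intro hD
    have hs := hD.smooth
    obtain ⟨hF, hk, hγ, hΨ, hW, hZ, hL⟩ := hD
    rw [linEinsteinMaxwell_iff _ _ _ _ hs, linMaxwell_localAdS3_iff hR hh hΨ hZ] at hL
    simp only [linSource_zero, sub_zero] at hL
    exact ⟨⟨hF, hk, hγ, (linVacuumEinstein_iff _ _ _ _ hs.1).2 hL.1⟩, hL.2⟩
  · rintro ⟨⟨hF, hk, hγ, hV⟩, hx⟩
    have hZ : SmoothPeriodic R d.Z := (smoothPeriodic_const R 0).congr fun x => (hx x).1
    have hΨ : SmoothPeriodic R d.Ψ := (smoothPeriodic_const R 0).congr fun x => (hx x).2.1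
    have hW : SmoothPeriodic R d.W := (smoothPeriodic_const R 0).congr fun x => (hx x).2.2
    have hs : d.Smooth := ⟨⟨hF.1, hk.1, hγ.1⟩, hΨ.1, hW.1, hZ.1⟩
    refine ⟨hF, hk, hγ, hΨ, hW, hZ, ?_⟩
    rw [linEinsteinMaxwell_iff _ _ _ _ hs, linMaxwell_localAdS3_iff hR hh hΨ hZ]
    simp only [linSource_zero, sub_zero]
    exact ⟨(linVacuumEinstein_iff _ _ _ _ hs.1).1 hV, hx⟩

theorem isVacuumDeformation_localAdS3_iff (h : ℝ) (d : FirstOrderData) :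
    IsVacuumDeformation (-((1 / 2) * h ^ 2)) R (constHorizon 0 h 0) d ↔
      SmoothPeriodic R d.γ ∧ ∀ x, d.h x = (1 / 4) * h * d.γ x ∧ d.F x = 0 := by
  constructor
  · rintro ⟨hF, hk, hγ, hV⟩
    have hs : d.MetricSmooth := ⟨hF.1, hk.1, hγ.1⟩
    exact ⟨hγ, (linVacuum_localAdS3_iff h hs).1 ((linVacuumEinstein_iff _ _ _ _ hs).1 hV)⟩
  · rintro ⟨hγ, hx⟩
    have hk : SmoothPeriodic R d.h := (hγ.const_mul ((1 / 4) * h)).congr fun x => (hx x).1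
    have hF : SmoothPeriodic R d.F := (smoothPeriodic_const R 0).congr fun x => (hx x).2
    have hs : d.MetricSmooth := ⟨hF.1, hk.1, hγ.1⟩
    exact ⟨hF, hk, hγ, (linVacuumEinstein_iff _ _ _ _ hs).2 ((linVacuum_localAdS3_iff h hs).2 hx)⟩

end LocalAdS3

end ExtremeHorizon

end

/-! ### Assembly of the theorem. -/

theorem mainTheorem6 (ℓ R Λ : ℝ) (hℓ : 0 < ℓ) (hR : 0 < R) (hΛ : Λ = -2 / ℓ ^ 2) :
    -- the possible horizons
    (∀ H : ExtremeHorizon.HorizonData,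
      ExtremeHorizon.IsNearHorizonGeometry Λ R H ↔
        ∃ σ : ℝ, (σ = 1 ∨ σ = -1) ∧
          (H = ExtremeHorizon.adS2S1 ℓ σ ∨ H = ExtremeHorizon.localAdS3 ℓ σ)) ∧
    ∀ σ : ℝ, (σ = 1 ∨ σ = -1) →
      -- AdS₂ × S¹: all deformations
      (∀ d : ExtremeHorizon.FirstOrderData,
        ExtremeHorizon.IsTransverseDeformation Λ R (ExtremeHorizon.adS2S1 ℓ σ) d ↔
          ExtremeHorizon.SmoothPeriodic R d.γ ∧
          ∃ a : ℝ, ∀ x : ℝ,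
            d.Z x = a + (1 / 2) * (σ / ℓ) *
              ∫ y in (0 : ℝ)..x, (d.γ y - ExtremeHorizon.mean R d.γ) ∧
            d.h x = 2 * (σ / ℓ) * d.Z x ∧
            d.F x = (1 / 3) * (σ / ℓ) ^ 2 * ExtremeHorizon.mean R d.γ ∧
            d.Ψ x = -((1 / 2) * (σ / ℓ) * ExtremeHorizon.mean R d.γ) ∧
            d.W x = 0) ∧
      -- AdS₂ × S¹: action of the gauge transformations
      (∀ d d' : ExtremeHorizon.FirstOrderData, ∀ f : ℝ → ℝ,
        ExtremeHorizon.IsTransverseDeformation Λ R (ExtremeHorizon.adS2S1 ℓ σ) d →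
        ExtremeHorizon.SmoothPeriodic R f →
        ExtremeHorizon.IsGaugeTransform (ExtremeHorizon.adS2S1 ℓ σ) f d d' →
          ExtremeHorizon.IsTransverseDeformation Λ R (ExtremeHorizon.adS2S1 ℓ σ) d' ∧
          ∀ x : ℝ, d'.γ x = d.γ x + deriv (deriv f) x) ∧
      -- AdS₂ × S¹: `γ⁽¹⁾` can be changed arbitrarily by gauge, up to its mean
      (∀ d : ExtremeHorizon.FirstOrderData,
        ExtremeHorizon.IsTransverseDeformation Λ R (ExtremeHorizon.adS2S1 ℓ σ) d →
        ∀ u : ℝ → ℝ, ExtremeHorizon.SmoothPeriodic R u →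
          ((∃ d' : ExtremeHorizon.FirstOrderData,
              ExtremeHorizon.GaugeEquivalent R (ExtremeHorizon.adS2S1 ℓ σ) d d' ∧ d'.γ = u) ↔
            ExtremeHorizon.mean R u = ExtremeHorizon.mean R d.γ)) ∧
      -- AdS₂ × S¹: unique representatives with constant data
      (∀ d : ExtremeHorizon.FirstOrderData,
        ExtremeHorizon.IsTransverseDeformation Λ R (ExtremeHorizon.adS2S1 ℓ σ) d →
        ∃! ab : ℝ × ℝ,
          ExtremeHorizon.GaugeEquivalent R (ExtremeHorizon.adS2S1 ℓ σ) d
            (ExtremeHorizon.constData (σ / ℓ) ab.1 ab.2)) ∧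
      -- locally AdS₃: all deformations
      (∀ d : ExtremeHorizon.FirstOrderData,
        ExtremeHorizon.IsTransverseDeformation Λ R (ExtremeHorizon.localAdS3 ℓ σ) d ↔
          ExtremeHorizon.SmoothPeriodic R d.γ ∧
          ∀ x : ℝ, d.Z x = 0 ∧ d.h x = (1 / 4) * (2 * σ / ℓ) * d.γ x ∧
            d.F x = 0 ∧ d.Ψ x = 0 ∧ d.W x = 0) ∧
      -- locally AdS₃: the deformations are the vacuum ones
      (∀ d : ExtremeHorizon.FirstOrderData,
        ExtremeHorizon.IsTransverseDeformation Λ R (ExtremeHorizon.localAdS3 ℓ σ) d ↔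
          ExtremeHorizon.IsVacuumDeformation Λ R (ExtremeHorizon.localAdS3 ℓ σ) d ∧
          ∀ x : ℝ, d.Z x = 0 ∧ d.Ψ x = 0 ∧ d.W x = 0) := by
  refine ⟨ExtremeHorizon.isNearHorizonGeometry_iff hℓ hR hΛ, fun σ hσ => ?_⟩
  -- Through `σ² = 1` the cosmological constant becomes `-2ψ²` or `-½h²` in terms of the background
  -- constant, the form used by the lemmas above.
  have hσ2 : σ ^ 2 = 1 := by rcases hσ with rfl | rfl <;> norm_num
  have hψ : -2 / ℓ ^ 2 = -2 * (σ / ℓ) ^ 2 := by rw [div_pow, hσ2]; ring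
  have hh : -2 / ℓ ^ 2 = -((1 / 2) * (2 * σ / ℓ) ^ 2) := by rw [div_pow, mul_pow, hσ2]; ring
  have hh0 : 2 * σ / ℓ ≠ 0 := by
    have : σ ≠ 0 := fun h => by simp [h] at hσ2
    positivity
  have hi : ExtremeHorizon.adS2S1 ℓ σ
      = ExtremeHorizon.constHorizon (-2 * (σ / ℓ) ^ 2) 0 (σ / ℓ) := by
    rw [ExtremeHorizon.adS2S1_eq, hψ]
  have hvac := ExtremeHorizon.isTransverseDeformation_localAdS3_iff_vacuum hR hh0
  refine ⟨?_, ?_, ?_, ?_, ?_, ?_⟩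
  · rw [hi, hΛ, hψ]
    exact ExtremeHorizon.isTransverseDeformation_adS2S1_iff hR (σ / ℓ)
  · rw [hi, hΛ, hψ]
    intro d d' f hd hf hg
    rw [ExtremeHorizon.isGaugeTransform_iff (σ / ℓ) hf.1] at hg
    subst hg
    exact ⟨ExtremeHorizon.isTransverseDeformation_gaugeAct hd hf, fun x => rfl⟩
  · rw [hi, hΛ, hψ]
    intro d hd u hu
    simp only [ExtremeHorizon.gaugeEquivalent_iff]
    constructor
    · rintro ⟨_, ⟨f, hf, rfl⟩, rfl⟩
      exact ExtremeHorizon.mean_gaugeAct hd.2.2.1 hf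
    · intro hm
      obtain ⟨f, hf, hfu⟩ := ExtremeHorizon.exists_gaugeAct_γ_eq (ψ := σ / ℓ) hR hd.2.2.1 hu hm
      exact ⟨_, ⟨f, hf, rfl⟩, hfu⟩
  · rw [hi, hΛ, hψ]
    exact fun d hd => ExtremeHorizon.existsUnique_constData hR hd
  · rw [ExtremeHorizon.localAdS3_eq, hΛ, hh]
    intro d
    rw [hvac d, ExtremeHorizon.isVacuumDeformation_localAdS3_iff]
    constructor
    · rintro ⟨⟨hγ, hx⟩, hy⟩
      exact ⟨hγ, fun x => ⟨(hy x).1, (hx x).1, (hx x).2, (hy x).2⟩⟩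
    · rintro ⟨hγ, hx⟩
      exact ⟨⟨hγ, fun x => ⟨(hx x).2.1, (hx x).2.2.1⟩⟩,
        fun x => ⟨(hx x).1, (hx x).2.2.2⟩⟩
  · rw [ExtremeHorizon.localAdS3_eq, hΛ, hh]
    exact hvac
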